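/- Let $\Omega=(l_1,l_2)\times(l_3,l_4)$, let $\psi$ be a smooth function with interface $\Gamma_I=\{q\in\Omega:\psi(q)=0\}$, and let $p=(x_0,l_4)$ with $l_1<x_0<l_2$ be a point of the side $\Gamma_4=(l_1,l_2)\times\{l_4\}$ with $\psi(p)\neq 0$. Consider the problem $$-\nabla\cdot(a\nabla u)=f \ \text{ in } \Omega\setminus\Gamma_I,\qquad \frac{\partial u}{\partial \vec n}+\beta(x)u=g_4\ \text{ on }\Gamma_4,$$ with $a>0$. "Piecewise $C^k$" means $C^k$ on each side of $\{\psi=0\}$, up to the outer boundary of the rectangle. A superscript $(m,n)$ denotes the derivative $\partial_x^m\partial_y^n$ at $p$, and $\beta^{(n)},g_4^{(n)}$ are the derivatives at $x_0$. Let $\Lambda_N=\{(m,n)\in\mathbb N_0^2: m+n\le N\}$, $\Lambda_N^{H,1}=\{(m,n)\in\Lambda_N:n\le 1\}$ and $\Lambda_N^{H,2}=\Lambda_N\setminus\Lambda_N^{H,1}$. The differential equation and its derivatives at $p$ express every $u^{(m',n')}$ with $n'\ge 2$ as a linear combination of the $u^{(m,n)}$ with $n\le 1$ and of the $f^{(m,n)}$;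 let $A^{u}_{m',n',m,n}$ and $A^{f}_{m',n',m,n}$ be the coefficients in it. Put $$G_{m,n}(x,y)=\sum_{\ell=0}^{\lfloor m/2\rfloor}\frac{(-1)^\ell y^{n+2\ell}x^{m-2\ell}}{(n+2\ell)!(m-2\ell)!}+\sum_{(m',n')\in\Lambda_6^{H,2}\setminus\Lambda_{m+n}^{H,2}}A^u_{m',n',m,n}\frac{x^{m'}y^{n'}}{m'!n'!},$$ $$Q_{m,n}(x,y)=\sum_{\ell=1}^{1+\lfloor m/2\rfloor}\frac{(-1)^\ell y^{n+2\ell}x^{m-2\ell+2}}{(n+2\ell)!(m-2\ell+2)!}\frac1{a(p)}+\sum_{(m',n')\in\Lambda_6^{H,2}\setminus\Lambda_{m+n+2}^{H,2}}A^f_{m',n',m,n}\frac{x^{m'}y^{n'}}{m'!n'!}.$$ A 6-point scheme at $p$ consists of coefficients depending on $h>0$ (and on $a,\beta$, not on $u,f,g_4$) in $$\sum_{k=-1}^{1}\sum_{\ell=-1}^{0}C_{k,\ell}(h)\,u_h(x_0+kh,l_4+\ell h)=\sum_{(m,n)\in\Lambda_{N}}f^{(m,n)}C_{f,m,n}(h)+\sum_{n=0}^{N'}g_4^{(n)}C_{g_4,n}(h)$$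 (for some $N,N'$) with $\sum_{k,\ell}|C_{k,\ell}(h)|\ge\delta>0$ for all small $h$. It has order of accuracy $P$ if, for every solution $(u,f,g_4)$ of the problem in the smoothness class considered, the left-hand side with $u$ in place of $u_h$ minus the right-hand side is $O(h^{P+1})$ as $h\to0^+$, i.e. $O(h^P)$ after division by $h$. **(i)** Let $a$ be piecewise $C^6$ and $\beta$ piecewise $C^5$. Consider $C_{k,\ell}(h)=\sum_{i=0}^{6}c_{k,\ell,i}h^i$ satisfying, for $n=0,1,\dots,6$, $$\sum_{k=-1}^{1}\sum_{\ell=-1}^{0}C_{k,\ell}\Big(G_{n,0}(kh,\ell h)-\sum_{i=n}^{5}\binom in\beta^{(i-n)}G_{i,1}(kh,\ell h)\Big)=O(h^7)$$ (the inner sum is empty for $n=6$). This system has a nontrivial solution, i.e. one with $c_{k,\ell,0}\ne0$ for some $(k,\ell)$. For every solution, the scheme with $C_{f,m,n}=\sum_{k,\ell}C_{k,\ell}Q_{m,n}(kh,\ell h)$ for $(m,n)\in\Lambda_4$ and $C_{g_4,n}=\sum_{k,\ell}C_{k,\ell}G_{n,1}(kh,\ell h)$ for $0\le n\le5$ has a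 residual $O(h^7)$ for all solutions of the problem with $u$ piecewise $C^7$, $f$ piecewise $C^5$, $g_4$ piecewise $C^5$. In particular every nontrivial solution gives a 6-point scheme of order of accuracy six. **(ii)** Six is the maximum order of accuracy of a 6-point scheme at $p$ for (piecewise) smooth $\beta$ and $a$ in general position: for all smooth $a,\beta$ with $2a(p)\beta(x_0)\neq\partial_y a(p)$, the largest $P$ for which there is a 6-point scheme of order $P$ on smooth solutions is $6$. Consequently, $6$ is also the largest $P$ such that, for all smooth $a$ and $\beta$, there is a 6-point scheme of order $P$ on smooth solutions. -/

import Mathlib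

open Filter Topology Asymptotics
open scoped ContDiff Nat

noncomputable section

/-! ### The rectangle, the interface and the data -/

/-- The rectangle `Ω = (l₁, l₂) × (l₃, l₄)` together with the smooth level-set function `ψ` whose
zero set is the interface. -/
structure InterfaceDomain where
  l₁ : ℝ
  l₂ : ℝ
  l₃ : ℝ
  l₄ : ℝ
  lt₁₂ : l₁ < l₂
  lt₃₄ : l₃ < l₄
  ψ : ℝ × ℝ → ℝ
  smooth_ψ : ContDiff ℝ ∞ ψ

namespace InterfaceDomain

variable (D : InterfaceDomain)

/-- The open rectangle `Ω`. -/
def Ω : Set (ℝ × ℝ) := Set.Ioo D.l₁ D.l₂ ×ˢ Set.Ioo D.l₃ D.l₄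

/-- The interface `Γ_I`. -/
def interface : Set (ℝ × ℝ) := {q | q ∈ D.Ω ∧ D.ψ q = 0}

/-- The closed rectangle. -/
def box : Set (ℝ × ℝ) := Set.Icc D.l₁ D.l₂ ×ˢ Set.Icc D.l₃ D.l₄

/-- The closed rectangle without the zero set of `ψ`: the two subregions `Ω⁺` and `Ω⁻`, each
together with the part of the boundary of the rectangle that belongs to it. Since `ψ` is
continuous, the two pieces are relatively open in the closed rectangle and disjoint, so regularity
on this set is regularity up to the outer boundary in each of the two pieces (and nothing is asked
across the interface). -/
def regularSet : Set (ℝ × ℝ) := {q | q ∈ D.box ∧ D.ψ q ≠ 0}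

/-- Abscissae of the points of the upper side `Γ₄ = (l₁, l₂) × {l₄}` off the zero set of `ψ`. -/
def regularTop : Set ℝ := {x | x ∈ Set.Ioo D.l₁ D.l₂ ∧ D.ψ (x, D.l₄) ≠ 0}

/-- `∂v/∂x` on the closed rectangle (one-sided on its boundary). -/
def dx (v : ℝ × ℝ → ℝ) (q : ℝ × ℝ) : ℝ := fderivWithin ℝ v D.box q (1, 0)

/-- `∂v/∂y` on the closed rectangle (one-sided on its boundary). -/
def dy (v : ℝ × ℝ → ℝ) (q : ℝ × ℝ) : ℝ := fderivWithin ℝ v D.box q (0, 1)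

/-- `∂^{m+n} v / ∂x^m ∂y^n` on the closed rectangle (one-sided on its boundary). -/
def pd (m n : ℕ) (v : ℝ × ℝ → ℝ) : ℝ × ℝ → ℝ := D.dx^[m] (D.dy^[n] v)

/-- `∇ · (a ∇ u)`. -/
def divGrad (a u : ℝ × ℝ → ℝ) (q : ℝ × ℝ) : ℝ :=
  D.dx (fun z => a z * D.dx u z) q + D.dy (fun z => a z * D.dy u z) q

/-- Admissible coefficients: `a` is positive and of class `C^ka`, the Robin coefficient `β` is of
class `C^kb`, on either side of the interface and up to the boundary. -/
structure IsCoefficients (ka kb : WithTop ℕ∞) (a : ℝ × ℝ → ℝ) (β : ℝ → ℝ) : Prop where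
  pos : ∀ q ∈ D.regularSet, 0 < a q
  contDiff_a : ContDiffOn ℝ ka a D.regularSet
  contDiff_β : ContDiffOn ℝ kb β D.regularTop

/-- `u` (piecewise of class `C^ku`) solves `-∇ · (a ∇ u) = f` in `Ω \ Γ_I` with the Robin condition
`∂u/∂n + β u = g` on `Γ₄`, whose outward unit normal is `(0, 1)`; `f` is piecewise `C^kf`, `g` is
`C^kg`. The jumps of `u` across the interface and its boundary values on the three other sides are
free data of the problem. -/
structure IsSolution (a : ℝ × ℝ → ℝ) (β : ℝ → ℝ) (ku kf kg : WithTop ℕ∞)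
    (u f : ℝ × ℝ → ℝ) (g : ℝ → ℝ) : Prop where
  contDiff_u : ContDiffOn ℝ ku u D.regularSet
  contDiff_f : ContDiffOn ℝ kf f D.regularSet
  contDiff_g : ContDiffOn ℝ kg g D.regularTop
  pde : ∀ q ∈ D.Ω \ D.interface, - D.divGrad a u q = f q
  robin : ∀ x ∈ D.regularTop, D.dy u (x, D.l₄) + β x * u (x, D.l₄) = g x

end InterfaceDomain

/-! ### Index sets and the functions `G^H`, `Q^H` -/

/-- `Λ_N = {(m, n) : m + n ≤ N}`. -/
def Lam (N : ℕ) : Finset (ℕ × ℕ) :=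
  (Finset.range (N + 1) ×ˢ Finset.range (N + 1)).filter fun q => q.1 + q.2 ≤ N

/-- `Λ_N^{H,1}`: the indices of `Λ_N` with at most one derivative in `y`. -/
def LamH1 (N : ℕ) : Finset (ℕ × ℕ) := (Lam N).filter fun q => q.2 ≤ 1

/-- `Λ_N^{H,2} = Λ_N \ Λ_N^{H,1}`. -/
def LamH2 (N : ℕ) : Finset (ℕ × ℕ) := Lam N \ LamH1 N

/-- The recursion by which the equation determines all partial derivatives of a solution at a
point. Let `P, Q, R` be the partial derivatives there of `a_x / a`, `a_y / a`, `1 / a`, let `F` be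
those of `f`, and let `v m = u^{(m,0)}`, `w m = u^{(m,1)}`. Applying `∂_x^m ∂_y^n` to
`u_yy = - u_xx - (a_x / a) u_x - (a_y / a) u_y - (1 / a) f` gives `u^{(m, n+2)}`. -/
def jetOf (P Q R F : ℕ → ℕ → ℝ) (v w : ℕ → ℝ) : ℕ → ℕ → ℝ
  | m, 0 => v m
  | m, 1 => w m
  | m, n + 2 =>
      - jetOf P Q R F v w (m + 2) n
      - ∑ i ∈ Finset.range (m + 1), ∑ j ∈ Finset.range (n + 1),
          (m.choose i : ℝ) * (n.choose j : ℝ) *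
            (P i j * jetOf P Q R F v w (m - i + 1) (n - j)
              + Q i j * jetOf P Q R F v w (m - i) (n - j + 1)
              + R i j * F (m - i) (n - j))
termination_by _ n => n

namespace InterfaceDomain

variable (D : InterfaceDomain) (a : ℝ × ℝ → ℝ) (p : ℝ × ℝ)

/-- `jetOf` for the coefficient `a` at the base point `p`. -/
def jet (F : ℕ → ℕ → ℝ) (v w : ℕ → ℝ) : ℕ → ℕ → ℝ :=
  jetOf (fun i j => D.pd i j (fun q => D.dx a q / a q) p)
    (fun i j => D.pd i j (fun q => D.dy a q / a q) p)
    (fun i j => D.pd i j (fun q => 1 / a q) p) F v w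

/-- `A^{H,u}_{m',n',m,n}`: the coefficient of `u^{(m,n)}` (where `n ≤ 1`) in the expression of
`u^{(m',n')}` through the `u^{(i,0)}`, the `u^{(i,1)}` and the derivatives of `f`. -/
def AHu (m' n' m n : ℕ) : ℝ :=
  D.jet a p (fun _ _ => 0) (fun i => if i = m ∧ n = 0 then 1 else 0)
    (fun i => if i = m ∧ n = 1 then 1 else 0) m' n'

/-- `A^{H,f}_{m',n',m,n}`: the coefficient of `f^{(m,n)}` in the same expression. -/
def AHf (m' n' m n : ℕ) : ℝ :=
  D.jet a p (fun i j => if i = m ∧ j = n then 1 else 0) (fun _ => 0) (fun _ => 0) m' n'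

/-- `G^H_{M,m,n}(x, y)` with base point `p`. -/
def GH (M m n : ℕ) (x y : ℝ) : ℝ :=
  ∑ l ∈ Finset.range (m / 2 + 1),
      (-1) ^ l * (y ^ (n + 2 * l) * x ^ (m - 2 * l)) / ((n + 2 * l)! * (m - 2 * l)! : ℝ)
  + ∑ q ∈ LamH2 (M + 1) \ LamH2 (m + n),
      D.AHu a p q.1 q.2 m n * (x ^ q.1 * y ^ q.2 / (q.1 ! * q.2 ! : ℝ))

/-- `Q^H_{M,m,n}(x, y)` with base point `p`. -/
def QH (M m n : ℕ) (x y : ℝ) : ℝ :=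
  ∑ l ∈ Finset.Icc 1 (1 + m / 2),
      (-1) ^ l * (y ^ (n + 2 * l) * x ^ (m + 2 - 2 * l)) / ((n + 2 * l)! * (m + 2 - 2 * l)! : ℝ)
        * (1 / a p)
  + ∑ q ∈ LamH2 (M + 1) \ LamH2 (m + n + 2),
      D.AHf a p q.1 q.2 m n * (x ^ q.1 * y ^ q.2 / (q.1 ! * q.2 ! : ℝ))

end InterfaceDomain

/-! ### Six-point schemes at a point of the upper side -/

/-- Sum over the six stencil indices `(k, ℓ)`, `k ∈ {-1, 0, 1}`, `ℓ ∈ {-1, 0}`. -/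
def stencilSum (t : ℤ → ℤ → ℝ) : ℝ :=
  ∑ k ∈ Finset.Icc (-1 : ℤ) 1, ∑ l ∈ Finset.Icc (-1 : ℤ) 0, t k l

/-- A six-point scheme at a point of the upper side: for every mesh size `h` stencil coefficients
`C k ℓ h`, and a right-hand side that combines derivatives of `f` and of `g` at that point, of
orders up to `ordF` and `ordG`, with coefficients `Cf m n h` and `Cg n h`. -/
structure SixPointScheme where
  C : ℤ → ℤ → ℝ → ℝ
  ordF : ℕ
  ordG : ℕ
  Cf : ℕ → ℕ → ℝ → ℝ
  Cg : ℕ → ℝ → ℝ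

namespace SixPointScheme

variable (S : SixPointScheme)

/-- The stencil coefficients do not degenerate as `h → 0⁺` (otherwise a mere multiplication of the
scheme by a power of `h` would raise its formal order). -/
def IsNormalized : Prop :=
  ∃ δ : ℝ, 0 < δ ∧ ∀ᶠ h in 𝓝[>] (0 : ℝ), δ ≤ stencilSum fun k l => |S.C k l h|

/-- Left-hand side minus right-hand side of the scheme at `(x₀, l₄)`, for `u`, `f`, `g`. -/
def residual (D : InterfaceDomain) (x₀ : ℝ) (u f : ℝ × ℝ → ℝ) (g : ℝ → ℝ) (h : ℝ) : ℝ :=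
  (stencilSum fun k l => S.C k l h * u (x₀ + k * h, D.l₄ + l * h))
    - (∑ q ∈ Lam S.ordF, D.pd q.1 q.2 f (x₀, D.l₄) * S.Cf q.1 q.2 h
      + ∑ n ∈ Finset.range (S.ordG + 1), iteratedDeriv n g x₀ * S.Cg n h)

/-- Consistency of order `P` on the solutions of the given smoothness: the residual is
`O(h^(P+1))`, that is, `O(h^P)` after division by `h`. The scheme discretizes `h` times the
first-order boundary operator, whence the division. -/
def IsConsistent (D : InterfaceDomain) (x₀ : ℝ) (a : ℝ × ℝ → ℝ) (β : ℝ → ℝ)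
    (ku kf kg : WithTop ℕ∞) (P : ℕ) : Prop :=
  ∀ (u f : ℝ × ℝ → ℝ) (g : ℝ → ℝ), D.IsSolution a β ku kf kg u f g →
    (fun h => S.residual D x₀ u f g h) =O[𝓝[>] (0 : ℝ)] fun h => h ^ (P + 1)

/-- The scheme achieves the order of accuracy `P` at `(x₀, l₄)`. -/
def HasAccuracyOrder (D : InterfaceDomain) (x₀ : ℝ) (a : ℝ × ℝ → ℝ) (β : ℝ → ℝ)
    (ku kf kg : WithTop ℕ∞) (P : ℕ) : Prop :=
  S.IsNormalized ∧ S.IsConsistent D x₀ a β ku kf kg P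

end SixPointScheme

/-! ### The scheme of sixth order -/

/-- `C_{k,ℓ}(h) = ∑_{i=0}^{6} c_{k,ℓ,i} h^i`. -/
def polyCoeff (c : ℤ → ℤ → ℕ → ℝ) (k l : ℤ) (h : ℝ) : ℝ :=
  ∑ i ∈ Finset.range 7, c k l i * h ^ i

/-- Non-triviality of a solution: the stencil does not vanish at `h = 0`. -/
def IsNontrivial (c : ℤ → ℤ → ℕ → ℝ) : Prop :=
  ∃ k ∈ Finset.Icc (-1 : ℤ) 1, ∃ l ∈ Finset.Icc (-1 : ℤ) 0, c k l 0 ≠ 0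

/-- The linear system for the coefficients `c_{k,ℓ,i}`: for `n = 0, …, 6`
`∑_{k,ℓ} C_{k,ℓ} (G^H_{5,n,0}(kh, ℓh)
  - ∑_{i=n}^{5} (i choose n) β^{(i-n)} G^H_{5,i,1}(kh, ℓh) (1 - δ_{n,6})) = O(h^7)`. -/
def SolvesSystem (D : InterfaceDomain) (x₀ : ℝ) (a : ℝ × ℝ → ℝ) (β : ℝ → ℝ)
    (c : ℤ → ℤ → ℕ → ℝ) : Prop :=
  ∀ n ∈ Finset.range 7,
    (fun h : ℝ => stencilSum fun k l => polyCoeff c k l h *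
      (D.GH a (x₀, D.l₄) 5 n 0 (k * h) (l * h)
        - ∑ i ∈ Finset.Icc n 5, (i.choose n : ℝ) * iteratedDeriv (i - n) β x₀ *
            D.GH a (x₀, D.l₄) 5 i 1 (k * h) (l * h) * (1 - if n = 6 then 1 else 0)))
      =O[𝓝[>] (0 : ℝ)] fun h => h ^ 7

/-- The scheme with stencil coefficients `C_{k,ℓ}(h)` and right-hand side
`∑_{(m,n) ∈ Λ_4} f^{(m,n)} C_{f,m,n} + ∑_{n=0}^{5} g^{(n)} C_{g,n}`, where
`C_{f,m,n} = ∑_{k,ℓ} C_{k,ℓ} Q^H_{5,m,n}(kh, ℓh)` and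
`C_{g,n} = ∑_{k,ℓ} C_{k,ℓ} G^H_{5,n,1}(kh, ℓh)`. -/
def robinScheme (D : InterfaceDomain) (x₀ : ℝ) (a : ℝ × ℝ → ℝ) (c : ℤ → ℤ → ℕ → ℝ) :
    SixPointScheme where
  C := polyCoeff c
  ordF := 4
  ordG := 5
  Cf m n h := stencilSum fun k l =>
    polyCoeff c k l h * D.QH a (x₀, D.l₄) 5 m n (k * h) (l * h)
  Cg n h := stencilSum fun k l =>
    polyCoeff c k l h * D.GH a (x₀, D.l₄) 5 n 1 (k * h) (l * h)

end

/-!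
The differential equation and its derivatives determine the jet of a solution at the base point
linearly from `v_n = u^{(n,0)}`, `u^{(n,1)}` and the derivatives of `f`, and the Robin condition
expresses the `u^{(n,1)}` through the `v_n` and the derivatives of `g`. So the Taylor polynomial of
a solution is `∑ v_n T_n` plus data terms, where `T_n` is the Taylor polynomial of the solution with
vanishing data and `u(x, l₄) = (x - x₀)^n / n!`, and the linear system says that the stencil
annihilates `T_0, …, T_6` up to `O(h^7)`.

The part of `T_n` of lowest degree is `Re (x + i y)^n / n!`, and the part of degree `n + 1` depends
only on `b = β`, `P = a_x / a` and `Q = a_y / a`. Expanding in powers of `h`, the system is solved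
recursively, starting from a multiple of a fixed stencil; the only obstruction, at the first
correction for `n = 5`, vanishes identically.

Conversely, on the six points `720 Re (x + i y)^6 / 6! = 2 Re (x + i y)^2 / 2!`, so for a scheme of
order seven the leading moments of degrees `0, …, 4` and the combination of the next-order moments
of `T_6` and `T_2` with these weights are `O(h ‖C‖)`. If `2 b ≠ Q` they determine the stencil `C`,
and `‖C‖ = O(h ‖C‖)` contradicts the normalization.
-/

noncomputable section

open Finset

/-! ### The jet recursion -/

section JetRecursion

variable {P Q R F F' : ℕ → ℕ → ℝ} {v v' w w' : ℕ → ℝ}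

lemma jetOf_zero_right (m : ℕ) : jetOf P Q R F v w m 0 = v m := by rw [jetOf]

lemma jetOf_one_right (m : ℕ) : jetOf P Q R F v w m 1 = w m := by rw [jetOf]

lemma jetOf_congr (m n : ℕ) (hF : ∀ i j, i + j + 2 ≤ m + n → F i j = F' i j)
    (hv : ∀ i ≤ m + n, v i = v' i) (hw : ∀ i, i + 1 ≤ m + n → w i = w' i) :
    jetOf P Q R F v w m n = jetOf P Q R F' v' w' m n := by
  induction n using Nat.strong_induction_on generalizing m with
  | _ n ih =>
    match n with
    | 0 => rw [jetOf, jetOf, hv m (by omega)]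
    | 1 => rw [jetOf, jetOf, hw m (by omega)]
    | n + 2 =>
      have hlow : ∀ j < n + 2, ∀ i, i + j ≤ m + (n + 2) →
          jetOf P Q R F v w i j = jetOf P Q R F' v' w' i j := fun j hj i hij =>
        ih j hj i (fun _ _ _ => hF _ _ (by omega)) (fun _ _ => hv _ (by omega))
          (fun _ _ => hw _ (by omega))
      rw [jetOf, jetOf, hlow n (by omega) (m + 2) (by omega)]
      congr 1
      refine sum_congr rfl fun i hi => sum_congr rfl fun j hj => ?_
      rw [mem_range] at hi hj
      rw [hlow (n - j) (by omega) (m - i + 1) (by omega),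
        hlow (n - j + 1) (by omega) (m - i) (by omega), hF (m - i) (n - j) (by omega)]

lemma jetOf_add_smul (c : ℝ) (m n : ℕ) :
    jetOf P Q R (fun i j => F i j + c * F' i j) (fun i => v i + c * v' i)
      (fun i => w i + c * w' i) m n
      = jetOf P Q R F v w m n + c * jetOf P Q R F' v' w' m n := by
  induction n using Nat.strong_induction_on generalizing m with
  | _ n ih =>
    match n with
    | 0 => simp only [jetOf_zero_right]
    | 1 => simp only [jetOf_one_right]
    | n + 2 =>
      rw [jetOf, jetOf, jetOf, ih n (by omega), mul_sub, mul_neg, mul_sum, neg_add,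
        ← add_sub_add_comm, ← sum_add_distrib]
      congr 1
      refine sum_congr rfl fun i _ => ?_
      rw [mul_sum, ← sum_add_distrib]
      refine sum_congr rfl fun j hj => ?_
      rw [mem_range] at hj
      rw [ih (n - j) (by omega), ih (n - j + 1) (by omega)]
      ring

lemma jetOf_add (m n : ℕ) :
    jetOf P Q R (fun i j => F i j + F' i j) (fun i => v i + v' i) (fun i => w i + w' i) m n
      = jetOf P Q R F v w m n + jetOf P Q R F' v' w' m n := by
  simpa only [one_mul] using jetOf_add_smul 1 m n

lemma jetOf_zero (m n : ℕ) :
    jetOf P Q R (fun _ _ => 0) (fun _ => 0) (fun _ => 0) m n = 0 := by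
  simpa only [add_zero, left_eq_add] using jetOf_add (P := P) (Q := Q) (R := R)
    (F := fun _ _ => 0) (F' := fun _ _ => 0) (v := fun _ => 0) (v' := fun _ => 0)
    (w := fun _ => 0) (w' := fun _ => 0) m n

lemma jetOf_eq_zero (m n : ℕ) (hF : ∀ i j, i + j + 2 ≤ m + n → F i j = 0)
    (hv : ∀ i ≤ m + n, v i = 0) (hw : ∀ i, i + 1 ≤ m + n → w i = 0) :
    jetOf P Q R F v w m n = 0 := by
  rw [jetOf_congr m n hF hv hw, jetOf_zero]

lemma jetOf_sum {ι : Type*} (s : Finset ι) (c : ι → ℝ) (F : ι → ℕ → ℕ → ℝ) (v w : ι → ℕ → ℝ)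
    (m n : ℕ) :
    jetOf P Q R (fun i j => ∑ t ∈ s, c t * F t i j) (fun i => ∑ t ∈ s, c t * v t i)
      (fun i => ∑ t ∈ s, c t * w t i) m n
      = ∑ t ∈ s, c t * jetOf P Q R (F t) (v t) (w t) m n := by
  classical
  induction s using Finset.induction_on with
  | empty => simpa only [sum_empty] using jetOf_zero m n
  | insert t s ht ih =>
    rw [sum_insert ht, ← ih, add_comm, ← jetOf_add_smul]
    simp only [sum_insert ht, add_comm]

lemma jetOf_add_two_of_vanishing (m n : ℕ)
    (hJ : ∀ i j, i + j < m + n + 1 → jetOf P Q R F v w i j = 0)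
    (hF : ∀ i j, i + j < m + n → F i j = 0) :
    jetOf P Q R F v w m (n + 2) = - jetOf P Q R F v w (m + 2) n
      - (P 0 0 * jetOf P Q R F v w (m + 1) n + Q 0 0 * jetOf P Q R F v w m (n + 1)
        + R 0 0 * F m n) := by
  have hterm : ∀ i ≤ m, ∀ j ≤ n, i + j ≠ 0 →
      (m.choose i : ℝ) * (n.choose j : ℝ) * (P i j * jetOf P Q R F v w (m - i + 1) (n - j)
        + Q i j * jetOf P Q R F v w (m - i) (n - j + 1) + R i j * F (m - i) (n - j)) = 0 := by
    intro i hi j hj hij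
    rw [hJ _ _ (by omega), hJ _ _ (by omega), hF _ _ (by omega)]
    ring
  rw [jetOf, sum_eq_single_of_mem 0 (by simp), sum_eq_single_of_mem 0 (by simp)]
  · simp only [Nat.choose_zero_right, Nat.cast_one, mul_one, one_mul, Nat.sub_zero]
  · intro j hj hj0
    exact hterm 0 (Nat.zero_le m) j (mem_range_succ_iff.1 hj) (by omega)
  · intro i hi hi0
    exact sum_eq_zero fun j hj =>
      hterm i (mem_range_succ_iff.1 hi) j (mem_range_succ_iff.1 hj) (by omega)

end JetRecursion

lemma mem_Lam {N : ℕ} {q : ℕ × ℕ} : q ∈ Lam N ↔ q.1 + q.2 ≤ N := by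
  simp only [Lam, mem_filter, mem_product, mem_range]
  omega

lemma mem_LamH2 {N : ℕ} {q : ℕ × ℕ} : q ∈ LamH2 N ↔ q.1 + q.2 ≤ N ∧ 2 ≤ q.2 := by
  simp only [LamH2, LamH1, Finset.mem_sdiff, mem_filter, mem_Lam]
  omega

/-! ### Taylor polynomials and the functions `G^H`, `Q^H` -/

/-- The homogeneous part of degree `d` of the Taylor series at the origin with partial derivatives
`J i j`. -/
def homPart (J : ℕ → ℕ → ℝ) (d : ℕ) (x y : ℝ) : ℝ :=
  ∑ q ∈ antidiagonal d, J q.1 q.2 * (x ^ q.1 * y ^ q.2 / (q.1 ! * q.2 ! : ℝ))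

/-- The Taylor polynomial of degree `N` at the origin with partial derivatives `J i j`. -/
def taylorSum (J : ℕ → ℕ → ℝ) (N : ℕ) (x y : ℝ) : ℝ :=
  ∑ q ∈ Lam N, J q.1 q.2 * (x ^ q.1 * y ^ q.2 / (q.1 ! * q.2 ! : ℝ))

lemma taylorSum_mul (J : ℕ → ℕ → ℝ) (N : ℕ) (k l h : ℝ) :
    taylorSum J N (k * h) (l * h) = ∑ d ∈ range (N + 1), h ^ d * homPart J d k l := by
  rw [taylorSum, ← sum_fiberwise_of_maps_to (g := fun q => q.1 + q.2) (t := range (N + 1))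
    fun q hq => mem_range_succ_iff.2 (mem_Lam.1 hq)]
  refine sum_congr rfl fun d hd => ?_
  have hfiber : (Lam N).filter (fun q => q.1 + q.2 = d) = antidiagonal d := by
    ext q
    rw [mem_range] at hd
    rw [mem_filter, mem_Lam, HasAntidiagonal.mem_antidiagonal]
    omega
  rw [hfiber, homPart, mul_sum]
  refine sum_congr rfl fun q hq => ?_
  rw [← HasAntidiagonal.mem_antidiagonal.1 hq, mul_pow, mul_pow, pow_add]
  ring

lemma taylorSum_eq_homPart_add {J : ℕ → ℕ → ℝ} {d N : ℕ} (hd : d ≤ N)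
    (hlow : ∀ i j, i + j < d → J i j = 0) (haxis : ∀ i j, d < i + j → j ≤ 1 → J i j = 0)
    (x y : ℝ) :
    taylorSum J N x y = homPart J d x y
      + ∑ q ∈ LamH2 N \ LamH2 d, J q.1 q.2 * (x ^ q.1 * y ^ q.2 / (q.1 ! * q.2 ! : ℝ)) := by
  have hmem : ∀ q, q ∈ antidiagonal d ∪ (LamH2 N \ LamH2 d) ↔
      q.1 + q.2 = d ∨ (d < q.1 + q.2 ∧ q.1 + q.2 ≤ N ∧ 2 ≤ q.2) := fun q => by
    rw [mem_union, HasAntidiagonal.mem_antidiagonal, Finset.mem_sdiff, mem_LamH2, mem_LamH2]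
    omega
  have hdisj : Disjoint (antidiagonal d) (LamH2 N \ LamH2 d) :=
    disjoint_left.2 fun q hq hq' => by
      rw [HasAntidiagonal.mem_antidiagonal] at hq
      rw [Finset.mem_sdiff, mem_LamH2, mem_LamH2] at hq'
      omega
  rw [taylorSum, homPart, ← sum_union hdisj]
  refine (sum_subset (fun q hq => ?_) fun q hq hq' => ?_).symm
  · rw [hmem] at hq
    rw [mem_Lam]
    omega
  · rw [mem_Lam] at hq
    rw [hmem] at hq'
    rcases lt_or_ge (q.1 + q.2) d with h | h
    · rw [hlow _ _ h, zero_mul]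
    · rw [haxis _ _ (by omega) (by omega), zero_mul]

lemma homPart_eq_sum_of_alternating {J : ℕ → ℕ → ℝ} {e s : ℕ} {c : ℝ}
    (hJ : ∀ i j, i + j = e + s →
      J i j = if s ≤ j ∧ j % 2 = s % 2 then (-1) ^ ((j - s) / 2) * c else 0) (x y : ℝ) :
    homPart J (e + s) x y = ∑ l ∈ range (e / 2 + 1),
      (-1) ^ l * (y ^ (s + 2 * l) * x ^ (e - 2 * l)) / ((s + 2 * l)! * (e - 2 * l)! : ℝ) * c := by
  symm
  refine sum_of_injOn (fun l => (e - 2 * l, s + 2 * l)) ?_ ?_ ?_ ?_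
  · intro l _ l' _ h
    simp only [Prod.mk.injEq] at h
    omega
  · intro l hl
    simp only [coe_range, Set.mem_Iio] at hl
    rw [mem_coe, HasAntidiagonal.mem_antidiagonal]
    dsimp only
    omega
  · intro q hq hnot
    rw [HasAntidiagonal.mem_antidiagonal] at hq
    rw [hJ _ _ hq, if_neg, zero_mul]
    refine fun hpar => hnot ⟨(q.2 - s) / 2, ?_, ?_⟩
    · simp only [coe_range, Set.mem_Iio]
      omega
    · ext <;> simp only <;> omega
  · intro l hl
    rw [mem_range] at hl
    rw [hJ _ _ (by omega), if_pos (by omega), show (s + 2 * l - s) / 2 = l by omega]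
    ring

namespace InterfaceDomain

variable (D : InterfaceDomain) (a : ℝ × ℝ → ℝ) (p : ℝ × ℝ)

lemma AHu_zero_right (i m n : ℕ) : D.AHu a p i 0 m n = if i = m ∧ n = 0 then 1 else 0 :=
  jetOf_zero_right i

lemma AHu_one_right (i m n : ℕ) : D.AHu a p i 1 m n = if i = m ∧ n = 1 then 1 else 0 :=
  jetOf_one_right i

lemma AHf_zero_right (i m n : ℕ) : D.AHf a p i 0 m n = 0 := jetOf_zero_right i

lemma AHf_one_right (i m n : ℕ) : D.AHf a p i 1 m n = 0 := jetOf_one_right i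

lemma AHu_eq_zero {m n i j : ℕ} (h : i + j < m + n) : D.AHu a p i j m n = 0 := by
  refine jetOf_eq_zero _ _ (fun _ _ _ => rfl) (fun _ _ => if_neg ?_) (fun _ _ => if_neg ?_) <;>
  omega

lemma AHf_eq_zero {m n i j : ℕ} (h : i + j < m + n + 2) : D.AHf a p i j m n = 0 := by
  refine jetOf_eq_zero _ _ (fun _ _ _ => if_neg ?_) (fun _ _ => rfl) (fun _ _ => rfl)
  omega

lemma AHu_of_degree_eq {m n i j : ℕ} (hn : n ≤ 1) (h : i + j = m + n) :
    D.AHu a p i j m n = if n ≤ j ∧ j % 2 = n % 2 then (-1) ^ ((j - n) / 2) * 1 else 0 := by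
  induction j using Nat.twoStepInduction generalizing i with
  | zero =>
    have hiff : (i = m ∧ n = 0) ↔ n ≤ 0 ∧ 0 % 2 = n % 2 := by omega
    simp only [AHu_zero_right, hiff, Nat.zero_sub, Nat.zero_div, pow_zero, mul_one]
  | one =>
    have hiff : (i = m ∧ n = 1) ↔ n ≤ 1 ∧ 1 % 2 = n % 2 := by omega
    have hexp : (1 - n) / 2 = 0 := by omega
    simp only [AHu_one_right, hiff, hexp, pow_zero, mul_one]
  | more j ih _ =>
    have hrec : D.AHu a p i (j + 2) m n = - D.AHu a p (i + 2) j m n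
        - (_ * D.AHu a p (i + 1) j m n + _ * D.AHu a p i (j + 1) m n + _ * 0) :=
      jetOf_add_two_of_vanishing i j (fun _ _ _ => D.AHu_eq_zero a p (by omega)) fun _ _ _ => rfl
    rw [hrec, ih (by omega), D.AHu_eq_zero a p (show i + 1 + j < m + n by omega),
      D.AHu_eq_zero a p (show i + (j + 1) < m + n by omega)]
    by_cases hpar : n ≤ j ∧ j % 2 = n % 2
    · rw [if_pos hpar, if_pos (by omega), show (j + 2 - n) / 2 = (j - n) / 2 + 1 by omega]
      ring
    · rw [if_neg hpar, if_neg (by omega)]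
      ring

lemma AHf_of_degree_eq {m n i j : ℕ} (h : i + j = m + (n + 2)) :
    D.AHf a p i j m n
      = if n + 2 ≤ j ∧ j % 2 = (n + 2) % 2 then (-1) ^ ((j - (n + 2)) / 2) * -(1 / a p)
        else 0 := by
  induction j using Nat.twoStepInduction generalizing i with
  | zero => rw [AHf_zero_right, if_neg (by omega)]
  | one => rw [AHf_one_right, if_neg (by omega)]
  | more j ih _ =>
    have hrec : D.AHf a p i (j + 2) m n = - D.AHf a p (i + 2) j m n
        - (_ * D.AHf a p (i + 1) j m n + _ * D.AHf a p i (j + 1) m n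
          + 1 / a p * if i = m ∧ j = n then 1 else 0) :=
      jetOf_add_two_of_vanishing i j (fun _ _ _ => D.AHf_eq_zero a p (by omega))
        fun _ _ _ => if_neg (by omega)
    rw [hrec, ih (by omega), D.AHf_eq_zero a p (show i + 1 + j < m + n + 2 by omega),
      D.AHf_eq_zero a p (show i + (j + 1) < m + n + 2 by omega)]
    rcases lt_trichotomy j n with hlt | rfl | hgt
    · rw [if_neg (by omega), if_neg (by omega), if_neg (by omega)]
      ring
    · rw [if_neg (by omega), if_pos (by omega), if_pos (by omega), Nat.sub_self]
      ring
    · rw [if_neg (show ¬ (i = m ∧ j = n) by omega)]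
      by_cases hpar : n + 2 ≤ j ∧ j % 2 = (n + 2) % 2
      · rw [if_pos hpar, if_pos (by omega),
          show (j + 2 - (n + 2)) / 2 = (j - (n + 2)) / 2 + 1 by omega]
        ring
      · rw [if_neg hpar, if_neg (by omega)]
        ring

lemma GH_eq_taylorSum {M m n : ℕ} (hn : n ≤ 1) (hmn : m + n ≤ M + 1) (x y : ℝ) :
    D.GH a p M m n x y = taylorSum (fun i j => D.AHu a p i j m n) (M + 1) x y := by
  rw [GH, taylorSum_eq_homPart_add hmn (fun _ _ => D.AHu_eq_zero a p) (fun i j hij hj => ?_),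
    homPart_eq_sum_of_alternating fun _ _ => D.AHu_of_degree_eq a p hn]
  · simp only [mul_one]
  · rcases Nat.le_one_iff_eq_zero_or_eq_one.1 hj with rfl | rfl
    · exact (D.AHu_zero_right a p i m n).trans (if_neg (by omega))
    · exact (D.AHu_one_right a p i m n).trans (if_neg (by omega))

lemma QH_eq_taylorSum {M m n : ℕ} (hmn : m + (n + 2) ≤ M + 1) (x y : ℝ) :
    D.QH a p M m n x y = taylorSum (fun i j => D.AHf a p i j m n) (M + 1) x y := by
  rw [QH, taylorSum_eq_homPart_add hmn (fun _ _ => D.AHf_eq_zero a p) (fun i j _ hj => ?_),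
    homPart_eq_sum_of_alternating fun _ _ => D.AHf_of_degree_eq a p, add_assoc m n 2]
  · have hIcc : Icc 1 (1 + m / 2) = Ico (0 + 1) (m / 2 + 1 + 1) := by
      ext l
      rw [mem_Icc, mem_Ico]
      omega
    rw [hIcc, ← sum_Ico_add', ← range_eq_Ico]
    congr 1
    refine sum_congr rfl fun l _ => ?_
    rw [show n + 2 * (l + 1) = n + 2 + 2 * l by omega,
      show m + 2 - 2 * (l + 1) = m - 2 * l by omega, pow_succ]
    ring
  · rcases Nat.le_one_iff_eq_zero_or_eq_one.1 hj with rfl | rfl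
    · exact D.AHf_zero_right a p i m n
    · exact D.AHf_one_right a p i m n

lemma jet_eq_sum (F : ℕ → ℕ → ℝ) (v w : ℕ → ℝ) {N m n : ℕ} (hmn : m + n ≤ N + 2) :
    D.jet a p F v w m n = ∑ i ∈ range (N + 3), v i * D.AHu a p m n i 0
      + ∑ i ∈ range (N + 2), w i * D.AHu a p m n i 1
      + ∑ q ∈ Lam N, F q.1 q.2 * D.AHf a p m n q.1 q.2 := by
  simp only [AHu, AHf, jet]
  rw [← jetOf_sum, ← jetOf_sum, ← jetOf_sum, ← jetOf_add, ← jetOf_add]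
  refine jetOf_congr _ _ (fun i j hij => ?_) (fun i hi => ?_) (fun i hi => ?_)
  · have hpair : ∀ q : ℕ × ℕ, (i = q.1 ∧ j = q.2) ↔ (i, j) = q := fun _ =>
      Prod.mk_inj.symm
    simp only [hpair, mul_zero, mul_ite, mul_one, sum_const_zero, zero_add, sum_ite_eq, mem_Lam]
    rw [if_pos (by omega)]
  · have hi' : i ∈ range (N + 3) := mem_range.2 (by omega)
    simp only [and_true, one_ne_zero, and_false, if_false, mul_ite, mul_one, mul_zero,
      sum_const_zero, add_zero, sum_ite_eq, hi', if_true]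
  · have hi' : i ∈ range (N + 2) := mem_range.2 (by omega)
    simp only [and_true, zero_ne_one, and_false, if_false, mul_ite, mul_one, mul_zero,
      sum_const_zero, add_zero, zero_add, sum_ite_eq, hi', if_true]

lemma taylorSum_jet (F : ℕ → ℕ → ℝ) (v w : ℕ → ℝ) (N : ℕ) (x y : ℝ) :
    taylorSum (D.jet a p F v w) (N + 2) x y
      = ∑ i ∈ range (N + 3), v i * D.GH a p (N + 1) i 0 x y
        + ∑ i ∈ range (N + 2), w i * D.GH a p (N + 1) i 1 x y
        + ∑ q ∈ Lam N, F q.1 q.2 * D.QH a p (N + 1) q.1 q.2 x y := by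
  have hv : ∀ i ∈ range (N + 3), v i * D.GH a p (N + 1) i 0 x y
      = v i * taylorSum (fun m n => D.AHu a p m n i 0) (N + 2) x y := fun i hi => by
    rw [D.GH_eq_taylorSum a p zero_le_one (mem_range_succ_iff.1 hi)]
  have hw : ∀ i ∈ range (N + 2), w i * D.GH a p (N + 1) i 1 x y
      = w i * taylorSum (fun m n => D.AHu a p m n i 1) (N + 2) x y := fun i hi => by
    rw [D.GH_eq_taylorSum a p le_rfl (Nat.succ_le_succ (mem_range_succ_iff.1 hi))]
  have hF : ∀ q ∈ Lam N, F q.1 q.2 * D.QH a p (N + 1) q.1 q.2 x y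
      = F q.1 q.2 * taylorSum (fun m n => D.AHf a p m n q.1 q.2) (N + 2) x y := fun q hq => by
    rw [mem_Lam] at hq
    rw [D.QH_eq_taylorSum a p (by omega)]
  rw [sum_congr rfl hv, sum_congr rfl hw, sum_congr rfl hF]
  simp only [taylorSum, mul_sum]
  rw [sum_comm, sum_comm (s := range (N + 2)), sum_comm (s := Lam N), ← sum_add_distrib,
    ← sum_add_distrib]
  refine sum_congr rfl fun q hq => ?_
  simp only [D.jet_eq_sum a p F v w (mem_Lam.1 hq), add_mul, sum_mul, mul_assoc]

end InterfaceDomain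
/-! ### Solutions of the homogeneous equation with homogeneous Robin data -/

/-- The partial derivatives `∂_x^{n-j} ∂_y^j` of `Re (x + i y) ^ n / n!`, that is, `Re (i ^ j)`. -/
def leadCoeff : ℕ → ℝ
  | 0 => 1
  | 1 => 0
  | j + 2 => - leadCoeff j

/-- The partial derivatives `∂_x^{n+1-j} ∂_y^j` at the base point of the solution with boundary
values `x ^ n / n!`, for the values `b` of `β`, `P` of `a_x / a` and `Q` of `a_y / a` there. -/
def nextCoeff (b P Q : ℝ) : ℕ → ℝ
  | 0 => 0
  | 1 => - b
  | j + 2 => - nextCoeff b P Q j - (P * leadCoeff j + Q * leadCoeff (j + 1))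

/-- A family of jets whose `n`-th member agrees, up to degree `n + 1`, with the solution of the
homogeneous equation with homogeneous Robin data that restricts to `x ^ n / n!` on the boundary. -/
structure IsRobinFamily (b P Q : ℝ) (J : ℕ → ℕ → ℕ → ℝ) : Prop where
  low : ∀ n i j, i + j < n → J n i j = 0
  lead : ∀ n i j, i + j = n → J n i j = leadCoeff j
  next : ∀ n i j, i + j = n + 1 → J n i j = nextCoeff b P Q j

namespace InterfaceDomain

variable (D : InterfaceDomain) (a : ℝ × ℝ → ℝ) (p : ℝ × ℝ) (b : ℕ → ℝ)

/-- The jet of a solution with `f = 0`, with `u(x, l₄) = (x - x₀) ^ n / n!` and with homogeneous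
Robin data, where `b` are the derivatives of `β`. -/
def robinJet (n : ℕ) : ℕ → ℕ → ℝ :=
  D.jet a p (fun _ _ => 0) (fun i => if i = n then 1 else 0)
    (fun i => - ((i.choose n : ℝ) * b (i - n)))

lemma robinJet_zero_right (n i : ℕ) : D.robinJet a p b n i 0 = if i = n then 1 else 0 :=
  jetOf_zero_right i

lemma robinJet_one_right (n i : ℕ) :
    D.robinJet a p b n i 1 = - ((i.choose n : ℝ) * b (i - n)) :=
  jetOf_one_right i

lemma robinJet_eq_zero {n i j : ℕ} (h : i + j < n) : D.robinJet a p b n i j = 0 :=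
  jetOf_eq_zero _ _ (fun _ _ _ => rfl) (fun _ _ => if_neg (by omega)) fun _ _ => by
    rw [Nat.choose_eq_zero_of_lt (by omega), Nat.cast_zero, zero_mul, neg_zero]

lemma robinJet_add_two {n i j : ℕ} (h : i + j + 1 ≤ n) :
    D.robinJet a p b n i (j + 2) = - D.robinJet a p b n (i + 2) j
      - (D.dx a p / a p * D.robinJet a p b n (i + 1) j
        + D.dy a p / a p * D.robinJet a p b n i (j + 1)) := by
  rw [← add_zero (D.dx a p / a p * _ + _), ← mul_zero (1 / a p)]
  exact jetOf_add_two_of_vanishing i j (fun _ _ _ => D.robinJet_eq_zero a p b (by omega))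
    fun _ _ _ => rfl

lemma robinJet_of_degree_eq {n i j : ℕ} (h : i + j = n) :
    D.robinJet a p b n i j = leadCoeff j := by
  induction j using Nat.twoStepInduction generalizing i with
  | zero => rw [robinJet_zero_right, if_pos (by omega), leadCoeff]
  | one =>
    rw [robinJet_one_right, Nat.choose_eq_zero_of_lt (by omega), leadCoeff, Nat.cast_zero,
      zero_mul, neg_zero]
  | more j ih _ =>
    rw [D.robinJet_add_two a p b (by omega), ih (by omega),
      D.robinJet_eq_zero a p b (show i + 1 + j < n by omega),
      D.robinJet_eq_zero a p b (show i + (j + 1) < n by omega), leadCoeff]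
    ring

lemma robinJet_of_degree_eq_succ {n i j : ℕ} (h : i + j = n + 1) :
    D.robinJet a p b n i j = nextCoeff (b 0) (D.dx a p / a p) (D.dy a p / a p) j := by
  induction j using Nat.twoStepInduction generalizing i with
  | zero => rw [robinJet_zero_right, if_neg (by omega), nextCoeff]
  | one =>
    obtain rfl : i = n := by omega
    rw [robinJet_one_right, nextCoeff, Nat.choose_self, Nat.cast_one, one_mul, Nat.sub_self]
  | more j ih _ =>
    rw [D.robinJet_add_two a p b (by omega), ih (by omega),
      D.robinJet_of_degree_eq a p b (show i + 1 + j = n by omega),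
      D.robinJet_of_degree_eq a p b (show i + (j + 1) = n by omega), nextCoeff]

lemma isRobinFamily_robinJet :
    IsRobinFamily (b 0) (D.dx a p / a p) (D.dy a p / a p) (D.robinJet a p b) where
  low _ _ _ := D.robinJet_eq_zero a p b
  lead _ _ _ := D.robinJet_of_degree_eq a p b
  next _ _ _ := D.robinJet_of_degree_eq_succ a p b

lemma taylorSum_robinJet_eq_sum_range {n N : ℕ} (hn : n ≤ N + 2) (x y : ℝ) :
    taylorSum (D.robinJet a p b n) (N + 2) x y = D.GH a p (N + 1) n 0 x y
      - ∑ i ∈ range (N + 2), (i.choose n : ℝ) * b (i - n) * D.GH a p (N + 1) i 1 x y := by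
  have hn' : n ∈ range (N + 3) := mem_range_succ_iff.2 hn
  rw [robinJet, taylorSum_jet]
  simp only [ite_mul, one_mul, zero_mul, sum_ite_eq', hn', if_true, neg_mul, sum_neg_distrib,
    sum_const_zero, add_zero, sub_eq_add_neg]

lemma taylorSum_robinJet {n N : ℕ} (hn : n ≤ N + 2) (x y : ℝ) :
    taylorSum (D.robinJet a p b n) (N + 2) x y = D.GH a p (N + 1) n 0 x y
      - ∑ i ∈ Icc n (N + 1), (i.choose n : ℝ) * b (i - n) * D.GH a p (N + 1) i 1 x y := by
  rw [D.taylorSum_robinJet_eq_sum_range a p b hn]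
  congr 1
  refine (sum_subset (fun i hi => ?_) fun i hi hi' => ?_).symm
  · exact mem_range_succ_iff.2 (mem_Icc.1 hi).2
  · rw [mem_range_succ_iff] at hi
    rw [mem_Icc] at hi'
    rw [Nat.choose_eq_zero_of_lt (by omega), Nat.cast_zero, zero_mul, zero_mul]

lemma taylorSum_jet_robin (F : ℕ → ℕ → ℝ) (v g : ℕ → ℝ) (N : ℕ) (x y : ℝ) :
    taylorSum (D.jet a p F v fun m => g m - ∑ n ∈ range (m + 1),
        (m.choose n : ℝ) * b (m - n) * v n) (N + 2) x y
      = ∑ n ∈ range (N + 3), v n * taylorSum (D.robinJet a p b n) (N + 2) x y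
        + (∑ q ∈ Lam N, F q.1 q.2 * D.QH a p (N + 1) q.1 q.2 x y
          + ∑ n ∈ range (N + 2), g n * D.GH a p (N + 1) n 1 x y) := by
  have hrobin : ∑ n ∈ range (N + 3), v n * taylorSum (D.robinJet a p b n) (N + 2) x y
      = ∑ n ∈ range (N + 3), v n * D.GH a p (N + 1) n 0 x y
        - ∑ m ∈ range (N + 2), ∑ n ∈ range (N + 3),
            (m.choose n : ℝ) * b (m - n) * v n * D.GH a p (N + 1) m 1 x y := by
    rw [sum_comm, ← sum_sub_distrib]
    refine sum_congr rfl fun n hn => ?_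
    rw [D.taylorSum_robinJet_eq_sum_range a p b (mem_range_succ_iff.1 hn), mul_sub, mul_sum]
    exact congrArg _ (sum_congr rfl fun m _ => by ring)
  have hextend : ∀ m ∈ range (N + 2), ∑ n ∈ range (N + 3),
        (m.choose n : ℝ) * b (m - n) * v n * D.GH a p (N + 1) m 1 x y
      = (∑ n ∈ range (m + 1), (m.choose n : ℝ) * b (m - n) * v n) * D.GH a p (N + 1) m 1 x y := by
    intro m hm
    rw [mem_range] at hm
    rw [sum_mul]
    refine (sum_subset (range_subset_range.2 (by omega)) fun n _ hn => ?_).symm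
    rw [mem_range_succ_iff, not_le] at hn
    rw [Nat.choose_eq_zero_of_lt hn, Nat.cast_zero, zero_mul, zero_mul, zero_mul]
  rw [hrobin, sum_congr rfl hextend, D.taylorSum_jet]
  simp only [sub_mul, sum_sub_distrib]
  ring

end InterfaceDomain

/-! ### Moments of six-point stencils -/

lemma stencilSum_eq (t : ℤ → ℤ → ℝ) :
    stencilSum t = t (-1) (-1) + t (-1) 0 + (t 0 (-1) + t 0 0) + (t 1 (-1) + t 1 0) := by
  have hk : Icc (-1 : ℤ) 1 = {-1, 0, 1} := by decide
  have hl : Icc (-1 : ℤ) 0 = {-1, 0} := by decide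
  rw [stencilSum, hk, hl]
  simp [add_assoc]

lemma stencilSum_add (s t : ℤ → ℤ → ℝ) :
    stencilSum (fun k l => s k l + t k l) = stencilSum s + stencilSum t := by
  simp only [stencilSum, sum_add_distrib]

lemma stencilSum_sub (s t : ℤ → ℤ → ℝ) :
    stencilSum (fun k l => s k l - t k l) = stencilSum s - stencilSum t := by
  simp only [stencilSum, sum_sub_distrib]

lemma stencilSum_mul_left (r : ℝ) (t : ℤ → ℤ → ℝ) :
    stencilSum (fun k l => r * t k l) = r * stencilSum t := by
  simp only [stencilSum, mul_sum]

lemma stencilSum_sum {ι : Type*} (s : Finset ι) (t : ι → ℤ → ℤ → ℝ) :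
    stencilSum (fun k l => ∑ i ∈ s, t i k l) = ∑ i ∈ s, stencilSum (t i) := by
  simp only [stencilSum_eq, sum_add_distrib]

lemma abs_le_stencilSum_abs (C : ℤ → ℤ → ℝ) {k l : ℤ} (hk : k ∈ Icc (-1 : ℤ) 1)
    (hl : l ∈ Icc (-1 : ℤ) 0) : |C k l| ≤ stencilSum fun k l => |C k l| :=
  (single_le_sum (fun l _ => abs_nonneg (C k l)) hl).trans
    (single_le_sum (f := fun k => ∑ l ∈ Icc (-1 : ℤ) 0, |C k l|)
      (fun _ _ => sum_nonneg fun _ _ => abs_nonneg _) hk)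

lemma isBigO_stencilSum {α : Type*} {F : Filter α} {t : ℤ → ℤ → α → ℝ} {g : α → ℝ}
    (ht : ∀ k ∈ Icc (-1 : ℤ) 1, ∀ l ∈ Icc (-1 : ℤ) 0, t k l =O[F] g) :
    (fun z => stencilSum fun k l => t k l z) =O[F] g :=
  IsBigO.sum fun k hk => IsBigO.sum fun l hl => ht k hk l hl

/-- The pairing of the stencil `C` with the homogeneous part of degree `d` of the Taylor series
with derivatives `J`. -/
def moment (J : ℕ → ℕ → ℝ) (d : ℕ) (C : ℤ → ℤ → ℝ) : ℝ :=
  stencilSum fun k l => C k l * homPart J d k l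

/-- The homogeneous part `Re (x + i y) ^ n / n!` of lowest degree of the `n`-th member of a Robin
family. -/
def leadPart (n : ℕ) (x y : ℝ) : ℝ := homPart (fun _ j => leadCoeff j) n x y

/-- The homogeneous part of degree `n + 1` of the `n`-th member of a Robin family. -/
def nextPart (b P Q : ℝ) (n : ℕ) (x y : ℝ) : ℝ :=
  homPart (fun _ j => nextCoeff b P Q j) (n + 1) x y

/-- The pairing of the stencil `C` with `leadPart n`. -/
def leadMoment (n : ℕ) (C : ℤ → ℤ → ℝ) : ℝ := stencilSum fun k l => C k l * leadPart n k l

/-- The pairing of the stencil `C` with `nextPart b P Q n`. -/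
def nextMoment (b P Q : ℝ) (n : ℕ) (C : ℤ → ℤ → ℝ) : ℝ :=
  stencilSum fun k l => C k l * nextPart b P Q n k l

lemma homPart_congr {J J' : ℕ → ℕ → ℝ} {d : ℕ} (h : ∀ i j, i + j = d → J i j = J' i j) :
    homPart J d = homPart J' d := by
  ext x y
  exact sum_congr rfl fun q hq => by rw [h _ _ (HasAntidiagonal.mem_antidiagonal.1 hq)]

lemma homPart_eq_zero {J : ℕ → ℕ → ℝ} {d : ℕ} (h : ∀ i j, i + j = d → J i j = 0) (x y : ℝ) :
    homPart J d x y = 0 :=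
  sum_eq_zero fun q hq => by rw [h _ _ (HasAntidiagonal.mem_antidiagonal.1 hq), zero_mul]

namespace IsRobinFamily

variable {b P Q : ℝ} {J : ℕ → ℕ → ℕ → ℝ} (hJ : IsRobinFamily b P Q J)

include hJ

lemma homPart_self (n : ℕ) : homPart (J n) n = leadPart n := homPart_congr (hJ.lead n)

lemma homPart_succ (n : ℕ) : homPart (J n) (n + 1) = nextPart b P Q n := homPart_congr (hJ.next n)

lemma homPart_of_lt {n d : ℕ} (hd : d < n) (x y : ℝ) : homPart (J n) d x y = 0 :=
  homPart_eq_zero (fun i j h => hJ.low n i j (h.trans_lt hd)) x y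

lemma moment_self (n : ℕ) (C : ℤ → ℤ → ℝ) : moment (J n) n C = leadMoment n C := by
  rw [moment, leadMoment, hJ.homPart_self]

lemma moment_succ (n : ℕ) (C : ℤ → ℤ → ℝ) :
    moment (J n) (n + 1) C = nextMoment b P Q n C := by
  rw [moment, nextMoment, hJ.homPart_succ]

lemma moment_of_lt {n d : ℕ} (hd : d < n) (C : ℤ → ℤ → ℝ) : moment (J n) d C = 0 := by
  simp only [moment, hJ.homPart_of_lt hd, mul_zero, stencilSum, sum_const_zero]

end IsRobinFamily

lemma leadPart_eq_sum_range (n : ℕ) (x y : ℝ) : leadPart n x y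
    = ∑ i ∈ range (n + 1), leadCoeff (n - i) * (x ^ i * y ^ (n - i) / (i ! * (n - i)! : ℝ)) :=
  Finset.Nat.sum_antidiagonal_eq_sum_range_succ_mk _ n

lemma nextPart_eq_sum_range (b P Q : ℝ) (n : ℕ) (x y : ℝ) : nextPart b P Q n x y
    = ∑ i ∈ range (n + 2), nextCoeff b P Q (n + 1 - i)
        * (x ^ i * y ^ (n + 1 - i) / (i ! * (n + 1 - i)! : ℝ)) :=
  Finset.Nat.sum_antidiagonal_eq_sum_range_succ_mk _ (n + 1)

lemma leadPart_zero (x y : ℝ) : leadPart 0 x y = 1 := by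
  simp only [leadPart_eq_sum_range, sum_range_succ, sum_range_zero, leadCoeff, Nat.factorial,
    Nat.reduceAdd, Nat.sub_self]
  push_cast
  ring

lemma leadPart_one (x y : ℝ) : leadPart 1 x y = x := by
  simp only [leadPart_eq_sum_range, sum_range_succ, sum_range_zero, leadCoeff, Nat.factorial,
    Nat.reduceSub, Nat.reduceAdd, Nat.sub_self]
  push_cast
  ring

lemma leadPart_two (x y : ℝ) : leadPart 2 x y = (x ^ 2 - y ^ 2) / 2 := by
  simp only [leadPart_eq_sum_range, sum_range_succ, sum_range_zero, leadCoeff, Nat.factorial,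
    Nat.reduceSub, Nat.reduceAdd, Nat.sub_self]
  push_cast
  ring

lemma leadPart_three (x y : ℝ) : leadPart 3 x y = (x ^ 3 - 3 * x * y ^ 2) / 6 := by
  simp only [leadPart_eq_sum_range, sum_range_succ, sum_range_zero, leadCoeff, Nat.factorial,
    Nat.reduceSub, Nat.reduceAdd, Nat.sub_self]
  push_cast
  ring

lemma leadPart_four (x y : ℝ) :
    leadPart 4 x y = (x ^ 4 - 6 * x ^ 2 * y ^ 2 + y ^ 4) / 24 := by
  simp only [leadPart_eq_sum_range, sum_range_succ, sum_range_zero, leadCoeff, Nat.factorial,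
    Nat.reduceSub, Nat.reduceAdd, Nat.sub_self]
  push_cast
  ring

lemma leadPart_five (x y : ℝ) :
    leadPart 5 x y = (x ^ 5 - 10 * x ^ 3 * y ^ 2 + 5 * x * y ^ 4) / 120 := by
  simp only [leadPart_eq_sum_range, sum_range_succ, sum_range_zero, leadCoeff, Nat.factorial,
    Nat.reduceSub, Nat.reduceAdd, Nat.sub_self]
  push_cast
  ring

lemma leadPart_six (x y : ℝ) :
    leadPart 6 x y = (x ^ 6 - 15 * x ^ 4 * y ^ 2 + 15 * x ^ 2 * y ^ 4 - y ^ 6) / 720 := by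
  simp only [leadPart_eq_sum_range, sum_range_succ, sum_range_zero, leadCoeff, Nat.factorial,
    Nat.reduceSub, Nat.reduceAdd, Nat.sub_self]
  push_cast
  ring

lemma nextPart_one (b P Q x y : ℝ) : nextPart b P Q 1 x y
    = - b * (x * y) - P * y ^ 2 / 2 := by
  simp only [nextPart_eq_sum_range, sum_range_succ, sum_range_zero, nextCoeff, leadCoeff,
    Nat.factorial, Nat.reduceSub, Nat.reduceAdd, Nat.sub_self]
  push_cast
  ring

lemma nextPart_two (b P Q x y : ℝ) : nextPart b P Q 2 x y
    = - b * (x ^ 2 * y) / 2 - P * (x * y ^ 2) / 2 + (b + Q) * y ^ 3 / 6 := by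
  simp only [nextPart_eq_sum_range, sum_range_succ, sum_range_zero, nextCoeff, leadCoeff,
    Nat.factorial, Nat.reduceSub, Nat.reduceAdd, Nat.sub_self]
  push_cast
  ring

lemma nextPart_three (b P Q x y : ℝ) : nextPart b P Q 3 x y
    = - b * (x ^ 3 * y) / 6 - P * (x ^ 2 * y ^ 2) / 4 + (b + Q) * (x * y ^ 3) / 6
      + P * y ^ 4 / 12 := by
  simp only [nextPart_eq_sum_range, sum_range_succ, sum_range_zero, nextCoeff, leadCoeff,
    Nat.factorial, Nat.reduceSub, Nat.reduceAdd, Nat.sub_self]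
  push_cast
  ring

lemma nextPart_five (b P Q x y : ℝ) : nextPart b P Q 5 x y
    = - b * (x ^ 5 * y) / 120 - P * (x ^ 4 * y ^ 2) / 48 + (b + Q) * (x ^ 3 * y ^ 3) / 36
      + P * (x ^ 2 * y ^ 4) / 24 - (b + 2 * Q) * (x * y ^ 5) / 120 - P * y ^ 6 / 240 := by
  simp only [nextPart_eq_sum_range, sum_range_succ, sum_range_zero, nextCoeff, leadCoeff,
    Nat.factorial, Nat.reduceSub, Nat.reduceAdd, Nat.sub_self]
  push_cast
  ring

lemma nextPart_six (b P Q x y : ℝ) : nextPart b P Q 6 x y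
    = - b * (x ^ 6 * y) / 720 - P * (x ^ 5 * y ^ 2) / 240 + (b + Q) * (x ^ 4 * y ^ 3) / 144
      + P * (x ^ 3 * y ^ 4) / 72 - (b + 2 * Q) * (x ^ 2 * y ^ 5) / 240
      - P * (x * y ^ 6) / 240 + (b + 3 * Q) * y ^ 7 / 5040 := by
  simp only [nextPart_eq_sum_range, sum_range_succ, sum_range_zero, nextCoeff, leadCoeff,
    Nat.factorial, Nat.reduceSub, Nat.reduceAdd, Nat.sub_self]
  push_cast
  ring

/-! ### Existence of stencils of sixth order -/

/-- The stencil with the values `E ± D` at `(±1, -1)`, `F ± K` at `(±1, 0)`, `A` at `(0, -1)` and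
`B` at `(0, 0)`, that is, in terms of its even and odd parts in `k`. -/
def stencilOf (A B E F D K : ℝ) (k l : ℤ) : ℝ :=
  if l = 0 then (if k = 0 then B else F + k * K) else (if k = 0 then A else E + k * D)

lemma stencilSum_stencilOf (A B E F D K : ℝ) (t : ℤ → ℤ → ℝ) :
    (stencilSum fun k l => stencilOf A B E F D K k l * t k l)
      = (E - D) * t (-1) (-1) + (F - K) * t (-1) 0 + (A * t 0 (-1) + B * t 0 0)
        + ((E + D) * t 1 (-1) + (F + K) * t 1 0) := by
  simp [stencilSum_eq, stencilOf, sub_eq_add_neg]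

-- `2 Re z - 5 Re z ^ 3 + 3 Re z ^ 5` vanishes at the six stencil points, whence the obstruction.
lemma exists_leadMoment_eq (r : ℕ → ℝ) :
    ∃ C : ℤ → ℤ → ℝ, (∀ n < 5, leadMoment n C = r n) ∧
      (2 * r 1 - 30 * r 3 + 360 * r 5 = 0 → leadMoment 5 C = r 5) := by
  refine ⟨stencilOf 0 (r 0 - (r 2 - 12 * r 4) / 2 - 2 * r 2) ((r 2 - 12 * r 4) / 4) (r 2)
    ((r 1 - 6 * r 3) / 6) (r 1 / 2 - (r 1 - 6 * r 3) / 6), fun n hn => ?_, fun h => ?_⟩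
  · rw [leadMoment, stencilSum_stencilOf]
    interval_cases n <;>
    simp only [leadPart_zero, leadPart_one, leadPart_two, leadPart_three, leadPart_four] <;>
    push_cast <;> ring
  · rw [leadMoment, stencilSum_stencilOf]
    simp only [leadPart_five]
    push_cast
    linear_combination (- 1 / 360) * h

/-- The stencil for which the leading-order system holds: it annihilates `Re (x + i y) ^ n` for
`n ≤ 6`. -/
def leadStencil : ℤ → ℤ → ℝ := stencilOf 4 (-10) 1 2 0 0

lemma leadMoment_leadStencil {n : ℕ} (hn : n ≤ 6) : leadMoment n leadStencil = 0 := by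
  rw [leadMoment, leadStencil, stencilSum_stencilOf]
  interval_cases n <;>
  simp only [leadPart_zero, leadPart_one, leadPart_two, leadPart_three, leadPart_four,
    leadPart_five, leadPart_six] <;>
  norm_num

lemma nextMoment_leadStencil (b P Q : ℝ) :
    2 * nextMoment b P Q 1 leadStencil - 30 * nextMoment b P Q 3 leadStencil
      + 360 * nextMoment b P Q 5 leadStencil = 0 := by
  simp only [nextMoment, leadStencil, stencilSum_stencilOf, nextPart_one, nextPart_three,
    nextPart_five]
  push_cast
  ring

lemma isBigO_pow_of_le {m n : ℕ} (hmn : m ≤ n) :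
    (fun h : ℝ => h ^ n) =O[𝓝[>] 0] fun h => h ^ m :=
  IsBigO.of_bound 1 <| by
    filter_upwards [Ioc_mem_nhdsGT one_pos] with h hh
    rw [one_mul, norm_pow, norm_pow]
    refine pow_le_pow_of_le_one (norm_nonneg h) ?_ hmn
    rw [Real.norm_of_nonneg hh.1.le]
    exact hh.2

lemma isBigO_sum_sum_pow {N : ℕ} {X : ℕ → ℕ → ℝ}
    (hX : ∀ e < N, ∑ q ∈ antidiagonal e, X q.1 q.2 = 0) :
    (fun h : ℝ => ∑ s ∈ range N, ∑ d ∈ range N, h ^ (s + d) * X s d)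
      =O[𝓝[>] 0] fun h => h ^ N := by
  have hlow : ∀ h : ℝ, ∑ q ∈ (range N ×ˢ range N).filter (fun q : ℕ × ℕ => q.1 + q.2 < N),
      h ^ (q.1 + q.2) * X q.1 q.2 = 0 := by
    intro h
    rw [← sum_fiberwise_of_maps_to (g := fun q : ℕ × ℕ => q.1 + q.2) (t := range N)
      fun q hq => mem_range.2 (mem_filter.1 hq).2]
    refine sum_eq_zero fun e he => ?_
    have hfiber : ((range N ×ˢ range N).filter (fun q : ℕ × ℕ => q.1 + q.2 < N)).filter
        (fun q => q.1 + q.2 = e) = antidiagonal e := by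
      ext q
      rw [mem_range] at he
      simp only [mem_filter, mem_product, mem_range, HasAntidiagonal.mem_antidiagonal]
      omega
    rw [hfiber, ← mul_zero (h ^ e), ← hX e (mem_range.1 he), mul_sum]
    exact sum_congr rfl fun q hq => by rw [HasAntidiagonal.mem_antidiagonal.1 hq]
  simp only [← sum_product', ← sum_filter_add_sum_filter_not (range N ×ˢ range N)
    (fun q : ℕ × ℕ => q.1 + q.2 < N), hlow, zero_add]
  refine IsBigO.fun_sum fun q hq => ?_
  simpa only [mul_comm] using
    (isBigO_pow_of_le (not_lt.1 (mem_filter.1 hq).2)).const_mul_left (X q.1 q.2)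

lemma stencilSum_polyCoeff_mul_taylorSum (c : ℤ → ℤ → ℕ → ℝ) (J : ℕ → ℕ → ℝ) (N : ℕ) (h : ℝ) :
    (stencilSum fun k l => polyCoeff c k l h * taylorSum J N (k * h) (l * h))
      = ∑ s ∈ range 7, ∑ d ∈ range (N + 1),
          h ^ (s + d) * moment J d fun k l => c k l s := by
  simp only [moment, taylorSum_mul, polyCoeff, sum_mul_sum, stencilSum_sum, ← stencilSum_mul_left]
  refine sum_congr rfl fun s _ => sum_congr rfl fun d _ => ?_
  congr 1
  ext k l
  ring

lemma exists_stencil_correction {b P Q : ℝ} {J : ℕ → ℕ → ℕ → ℝ} (hJ : IsRobinFamily b P Q J)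
    {c : ℕ → ℤ → ℤ → ℝ} (hc : c 0 = leadStencil) (t : ℕ) :
    ∃ C : ℤ → ℤ → ℝ, ∀ n, n + (t + 1) ≤ 6 →
      ∑ s ∈ range (t + 1), moment (J n) (n + (t + 1) - s) (c s) + leadMoment n C = 0 := by
  obtain ⟨C, hC, hC5⟩ := exists_leadMoment_eq
    fun n => - ∑ s ∈ range (t + 1), moment (J n) (n + (t + 1) - s) (c s)
  refine ⟨C, fun n hn => ?_⟩
  rw [add_comm, ← eq_neg_iff_add_eq_zero]
  rcases Nat.lt_or_ge n 5 with h5 | h5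
  · exact hC n h5
  · obtain rfl : n = 5 := by omega
    obtain rfl : t = 0 := by omega
    refine hC5 ?_
    simp only [zero_add, sum_range_one, tsub_zero, hc, hJ.moment_succ]
    linear_combination - nextMoment_leadStencil b P Q

lemma exists_stencil_expansion {b P Q : ℝ} {J : ℕ → ℕ → ℕ → ℝ} (hJ : IsRobinFamily b P Q J)
    (t : ℕ) : ∃ c : ℕ → ℤ → ℤ → ℝ, c 0 = leadStencil ∧ ∀ s ≤ t, ∀ n, n + s ≤ 6 →
      ∑ i ∈ range (s + 1), moment (J n) (n + s - i) (c i) = 0 := by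
  induction t with
  | zero =>
    refine ⟨fun _ => leadStencil, rfl, fun s hs n hn => ?_⟩
    obtain rfl : s = 0 := by omega
    rw [sum_range_one]
    exact (hJ.moment_self n _).trans (leadMoment_leadStencil hn)
  | succ t ih =>
    obtain ⟨c, hc0, hc⟩ := ih
    obtain ⟨C, hC⟩ := exists_stencil_correction hJ hc0 t
    have hold : ∀ i ≤ t, Function.update c (t + 1) C i = c i := fun i hi =>
      Function.update_of_ne (by omega) _ _
    have hsum : ∀ s ≤ t, ∀ f : ℕ → (ℤ → ℤ → ℝ) → ℝ,
        ∑ i ∈ range (s + 1), f i (Function.update c (t + 1) C i)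
          = ∑ i ∈ range (s + 1), f i (c i) := fun s hs f =>
      sum_congr rfl fun i hi => by rw [hold i ((mem_range_succ_iff.1 hi).trans hs)]
    refine ⟨Function.update c (t + 1) C, by rw [hold 0 (Nat.zero_le t), hc0], fun s hs n hn => ?_⟩
    rcases Nat.le_succ_iff.1 hs with hle | rfl
    · rw [hsum s hle fun i => moment (J n) (n + s - i), hc s hle n hn]
    · rw [sum_range_succ, hsum t le_rfl fun i => moment (J n) (n + (t + 1) - i),
        Function.update_self, Nat.add_sub_cancel, hJ.moment_self, hC n hn]

lemma exists_stencil_of_isRobinFamily {b P Q : ℝ} {J : ℕ → ℕ → ℕ → ℝ}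
    (hJ : IsRobinFamily b P Q J) :
    ∃ c : ℤ → ℤ → ℕ → ℝ, IsNontrivial c ∧ ∀ n ≤ 6,
      (fun h : ℝ => stencilSum fun k l => polyCoeff c k l h * taylorSum (J n) 6 (k * h) (l * h))
        =O[𝓝[>] 0] fun h => h ^ 7 := by
  obtain ⟨c, hc0, hc⟩ := exists_stencil_expansion hJ 6
  refine ⟨fun k l i => c i k l, ⟨0, by decide, 0, by decide, ?_⟩, fun n hn => ?_⟩
  · change c 0 0 0 ≠ 0
    rw [hc0, leadStencil, stencilOf, if_pos rfl, if_pos rfl]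
    norm_num
  · simp only [stencilSum_polyCoeff_mul_taylorSum]
    refine isBigO_sum_sum_pow (X := fun s d => moment (J n) d (c s)) fun e he => ?_
    rw [Finset.Nat.sum_antidiagonal_eq_sum_range_succ_mk]
    rcases Nat.lt_or_ge e n with hlt | hge
    · exact sum_eq_zero fun s _ => hJ.moment_of_lt (by omega) _
    · obtain ⟨s, rfl⟩ := Nat.exists_eq_add_of_le hge
      rw [← hc s (by omega) n (by omega)]
      refine (sum_subset (range_subset_range.2 (by omega)) fun i hi hi' => ?_).symm
      rw [mem_range] at hi hi'
      exact hJ.moment_of_lt (by omega) _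

/-! ### Optimality of the sixth order -/

lemma isBigO_of_pow_mul {f g : ℝ → ℝ} (n : ℕ)
    (hfg : (fun h => h ^ n * f h) =O[𝓝[>] 0] fun h => h ^ n * g h) : f =O[𝓝[>] 0] g := by
  refine ((isBigO_refl (fun h : ℝ => (h ^ n)⁻¹) (𝓝[>] 0)).mul hfg).congr' ?_ ?_ <;>
  filter_upwards [self_mem_nhdsWithin] with h hh <;>
  exact inv_mul_cancel_left₀ (pow_ne_zero n (ne_of_gt hh)) _

-- `Re z ^ 6 - Re z ^ 2` vanishes at the six stencil points.
lemma leadMoment_six (C : ℤ → ℤ → ℝ) : 720 * leadMoment 6 C = 2 * leadMoment 2 C := by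
  simp only [leadMoment, stencilSum_eq, leadPart_six, leadPart_two]
  push_cast
  ring

lemma isBigO_stencil_of_moments {α : Type*} {F : Filter α} {g : α → ℝ} {b P Q : ℝ}
    (hbQ : 2 * b ≠ Q) {C : ℤ → ℤ → α → ℝ}
    (hlead : ∀ n < 5, (fun z => leadMoment n fun k l => C k l z) =O[F] g)
    (hnext : (fun z => 720 * nextMoment b P Q 6 (fun k l => C k l z)
      - 2 * nextMoment b P Q 2 fun k l => C k l z) =O[F] g) :
    ∀ k ∈ Icc (-1 : ℤ) 1, ∀ l ∈ Icc (-1 : ℤ) 0, C k l =O[F] g := by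
  have e0 := hlead 0 (by norm_num)
  have e1 := hlead 1 (by norm_num)
  have e2 := hlead 2 (by norm_num)
  have e3 := hlead 3 (by norm_num)
  have e4 := hlead 4 (by norm_num)
  simp only [leadMoment, nextMoment, stencilSum_eq, leadPart_zero, leadPart_one, leadPart_two,
    leadPart_three, leadPart_four, nextPart_two, nextPart_six, Int.cast_neg, Int.cast_one,
    Int.cast_zero] at e0 e1 e2 e3 e4 hnext
  have hoddLower : (fun z => C 1 (-1) z - C (-1) (-1) z) =O[F] g :=
    ((e1.const_mul_left (1 / 3)).sub (e3.const_mul_left 2)).congr_left fun z => by ring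
  have hmidLower : C 0 (-1) =O[F] g := by
    have hne : 2 * b - Q ≠ 0 := sub_ne_zero.2 hbQ
    refine ((((hnext.sub (hoddLower.const_mul_left (5 * P))).const_mul_left
      (- (42 / 15) / (2 * b - Q))).sub (e2.const_mul_left (19 / 15))).add
      (e4.const_mul_left (19 * 12 / 15))).congr_left fun z => ?_
    field_simp
    ring
  have hevenLower : (fun z => C 1 (-1) z + C (-1) (-1) z) =O[F] g :=
    (((hmidLower.const_mul_left (1 / 2)).add (e2.const_mul_left (1 / 2))).sub
      (e4.const_mul_left 6)).congr_left fun z => by ring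
  have hevenUpper : (fun z => C 1 0 z + C (-1) 0 z) =O[F] g :=
    (hmidLower.add (e2.const_mul_left 2)).congr_left fun z => by ring
  have hoddUpper : (fun z => C 1 0 z - C (-1) 0 z) =O[F] g :=
    (e1.sub hoddLower).congr_left fun z => by ring
  have hmidUpper : C 0 0 =O[F] g :=
    (((e0.sub hmidLower).sub hevenLower).sub hevenUpper).congr_left fun z => by ring
  have hplus : ∀ {s t : α → ℝ}, (fun z => s z + t z) =O[F] g → (fun z => s z - t z) =O[F] g →
      s =O[F] g := fun he ho => ((he.add ho).const_mul_left (1 / 2)).congr_left fun z => by ring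
  have hminus : ∀ {s t : α → ℝ}, (fun z => s z + t z) =O[F] g → (fun z => s z - t z) =O[F] g →
      t =O[F] g := fun he ho => ((he.sub ho).const_mul_left (1 / 2)).congr_left fun z => by ring
  intro k hk l hl
  fin_cases hk <;> fin_cases hl
  exacts [hminus hevenLower hoddLower, hminus hevenUpper hoddUpper, hmidLower, hmidUpper,
    hplus hevenLower hoddLower, hplus hevenUpper hoddUpper]

lemma isBigO_coeff_stencilSum_abs {α : Type*} (F : Filter α) (C : ℤ → ℤ → α → ℝ) :
    ∀ k ∈ Icc (-1 : ℤ) 1, ∀ l ∈ Icc (-1 : ℤ) 0,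
      C k l =O[F] fun z => stencilSum fun k l => |C k l z| := fun _ hk _ hl =>
  IsBigO.of_bound' <| Eventually.of_forall fun z =>
    (abs_le_stencilSum_abs (fun k l => C k l z) hk hl).trans (le_abs_self _)

/-- The stencil values `W` of a function agree up to second order with those of the two leading
homogeneous parts of the `n`-th member of a Robin family. -/
def IsRobinExpansion (b P Q : ℝ) (n : ℕ) (W : ℤ → ℤ → ℝ → ℝ) : Prop :=
  ∀ k ∈ Icc (-1 : ℤ) 1, ∀ l ∈ Icc (-1 : ℤ) 0,
    (fun h => W k l h - (h ^ n * leadPart n k l + h ^ (n + 1) * nextPart b P Q n k l))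
      =O[𝓝[>] 0] fun h => h ^ (n + 2)

lemma IsRobinExpansion.isBigO_moments {b P Q : ℝ} {n : ℕ} {W : ℤ → ℤ → ℝ → ℝ}
    (hW : IsRobinExpansion b P Q n W) {C : ℤ → ℤ → ℝ → ℝ}
    (hC : (fun _ => (1 : ℝ)) =O[𝓝[>] 0] fun h => stencilSum fun k l => |C k l h|)
    (hCW : (fun h => stencilSum fun k l => C k l h * W k l h) =O[𝓝[>] 0] fun h => h ^ (n + 2)) :
    (fun h => leadMoment n (fun k l => C k l h) + h * nextMoment b P Q n fun k l => C k l h)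
      =O[𝓝[>] 0] fun h => h ^ 2 * stencilSum fun k l => |C k l h| := by
  refine isBigO_of_pow_mul n ?_
  have hremainder : (fun h => stencilSum fun k l => C k l h
      * (W k l h - (h ^ n * leadPart n k l + h ^ (n + 1) * nextPart b P Q n k l)))
      =O[𝓝[>] 0] fun h => h ^ (n + 2) * stencilSum fun k l => |C k l h| :=
    isBigO_stencilSum fun k hk l hl =>
      ((isBigO_coeff_stencilSum_abs _ C k hk l hl).mul (hW k hk l hl)).congr_right fun _ =>
        mul_comm _ _
  have htotal : (fun h => stencilSum fun k l => C k l h * W k l h)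
      =O[𝓝[>] 0] fun h => h ^ (n + 2) * stencilSum fun k l => |C k l h| := by
    simpa only [mul_one] using hCW.mul hC
  refine (htotal.sub hremainder).congr (fun h => ?_) fun h => ?_
  · simp only [leadMoment, nextMoment, stencilSum_eq]
    ring
  · rw [pow_add, mul_assoc]

lemma isLittleO_id_mul (σ : ℝ → ℝ) : (fun h => h * σ h) =o[𝓝[>] 0] σ := by
  have hid : (fun h : ℝ => h) =o[𝓝[>] 0] fun _ => (1 : ℝ) :=
    (isLittleO_one_iff ℝ).2 (tendsto_id.mono_left nhdsWithin_le_nhds)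
  simpa only [one_mul] using hid.mul_isBigO (isBigO_refl σ _)

lemma false_of_isRobinExpansion {b P Q : ℝ} (hbQ : 2 * b ≠ Q) {C : ℤ → ℤ → ℝ → ℝ} {δ : ℝ}
    (hδ : 0 < δ) (hC : ∀ᶠ h in 𝓝[>] (0 : ℝ), δ ≤ stencilSum fun k l => |C k l h|)
    {W : ℕ → ℤ → ℤ → ℝ → ℝ} (hW : ∀ n ≤ 6, IsRobinExpansion b P Q n (W n))
    (hCW : ∀ n ≤ 6, (fun h => stencilSum fun k l => C k l h * W n k l h)
      =O[𝓝[>] 0] fun h => h ^ 8) : False := by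
  set σ : ℝ → ℝ := fun h => stencilSum fun k l => |C k l h|
  have hone : (fun _ => (1 : ℝ)) =O[𝓝[>] 0] σ := by
    refine IsBigO.of_bound δ⁻¹ (hC.mono fun h hh => ?_)
    rw [norm_one, inv_mul_eq_div, one_le_div hδ]
    exact hh.trans (le_abs_self _)
  have hmoments : ∀ n ≤ 6, (fun h => leadMoment n (fun k l => C k l h)
      + h * nextMoment b P Q n fun k l => C k l h) =O[𝓝[>] 0] fun h => h ^ 2 * σ h := fun n hn =>
    (hW n hn).isBigO_moments hone ((hCW n hn).trans (isBigO_pow_of_le (by omega)))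
  have hnext : ∀ n, (fun h => nextMoment b P Q n fun k l => C k l h) =O[𝓝[>] 0] σ := fun n =>
    isBigO_stencilSum fun k hk l hl =>
      ((isBigO_coeff_stencilSum_abs _ C k hk l hl).const_mul_left
        (nextPart b P Q n k l)).congr_left fun h => mul_comm _ _
  have hlead : ∀ n ≤ 6, (fun h => leadMoment n fun k l => C k l h)
      =O[𝓝[>] 0] fun h => h * σ h := fun n hn => by
    have hsq : (fun h => h ^ 2 * σ h) =O[𝓝[>] 0] fun h => h * σ h := by
      simpa only [pow_one] using (isBigO_pow_of_le one_le_two).mul (isBigO_refl σ _)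
    refine (((hmoments n hn).trans hsq).sub
      ((isBigO_refl (fun h : ℝ => h) _).mul (hnext n))).congr_left fun h => by ring
  have hdiff : (fun h => 720 * nextMoment b P Q 6 (fun k l => C k l h)
      - 2 * nextMoment b P Q 2 fun k l => C k l h) =O[𝓝[>] 0] fun h => h * σ h := by
    refine isBigO_of_pow_mul 1 ((((hmoments 6 le_rfl).const_mul_left 720).sub
      ((hmoments 2 (by norm_num)).const_mul_left 2)).congr (fun h => ?_) fun h => by ring)
    linear_combination leadMoment_six fun k l => C k l h
  have hbound : σ =O[𝓝[>] 0] fun h => h * σ h := isBigO_stencilSum fun k hk l hl =>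
    (isBigO_stencil_of_moments hbQ (fun n hn => hlead n (by omega)) hdiff k hk l hl).abs_left
  exact isLittleO_irrefl (hC.mono fun h hh => (hδ.trans_le hh).ne').frequently
    (hbound.trans_isLittleO (isLittleO_id_mul σ))

/-! ### Calculus on the closed rectangle off the interface -/

namespace InterfaceDomain

variable (D : InterfaceDomain)

lemma isOpen_ne_zero : IsOpen {q | D.ψ q ≠ 0} :=
  isOpen_ne_fun D.smooth_ψ.continuous continuous_const

lemma regularSet_eq : D.regularSet = D.box ∩ {q | D.ψ q ≠ 0} := rfl

lemma uniqueDiffOn_box : UniqueDiffOn ℝ D.box :=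
  (uniqueDiffOn_Icc D.lt₁₂).prod (uniqueDiffOn_Icc D.lt₃₄)

lemma uniqueDiffOn_regularSet : UniqueDiffOn ℝ D.regularSet :=
  D.uniqueDiffOn_box.inter D.isOpen_ne_zero

lemma closure_Ω : closure D.Ω = D.box := by
  rw [Ω, closure_prod_eq, closure_Ioo D.lt₁₂.ne, closure_Ioo D.lt₃₄.ne, box]

lemma Ω_subset_box : D.Ω ⊆ D.box := D.closure_Ω ▸ subset_closure

lemma diff_interface_eq : D.Ω \ D.interface = {q | D.ψ q ≠ 0} ∩ D.Ω := by
  ext q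
  simp only [interface, Set.mem_sdiff, Set.mem_ofPred_eq, Set.mem_inter_iff]
  tauto

lemma regularSet_subset_closure : D.regularSet ⊆ closure (D.Ω \ D.interface) := by
  rw [diff_interface_eq]
  rintro q ⟨hq, hψ⟩
  exact D.isOpen_ne_zero.inter_closure ⟨hψ, D.closure_Ω ▸ hq⟩

lemma diff_interface_subset : D.Ω \ D.interface ⊆ D.regularSet := by
  rw [diff_interface_eq]
  exact fun q hq => ⟨D.Ω_subset_box hq.2, hq.1⟩

lemma mem_closure_interior {q : ℝ × ℝ} (hq : q ∈ D.regularSet) :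
    q ∈ closure (interior D.regularSet) := by
  refine closure_mono ?_ (D.regularSet_subset_closure hq)
  refine interior_maximal D.diff_interface_subset ?_
  rw [diff_interface_eq]
  exact D.isOpen_ne_zero.inter (isOpen_Ioo.prod isOpen_Ioo)

/-- The derivative on the closed rectangle in the direction `e` (one-sided on its boundary), a
common form of `dx` and `dy`. -/
def dirDeriv (e : ℝ × ℝ) (v : ℝ × ℝ → ℝ) (q : ℝ × ℝ) : ℝ := fderivWithin ℝ v D.box q e

lemma dx_eq_dirDeriv : D.dx = D.dirDeriv (1, 0) := rfl

lemma dy_eq_dirDeriv : D.dy = D.dirDeriv (0, 1) := rfl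

variable {D} {e e' : ℝ × ℝ} {v w : ℝ × ℝ → ℝ} {q : ℝ × ℝ}

lemma dirDeriv_eq (hq : q ∈ D.regularSet) :
    D.dirDeriv e v q = fderivWithin ℝ v D.regularSet q e := by
  rw [dirDeriv, regularSet_eq, fderivWithin_inter (D.isOpen_ne_zero.mem_nhds hq.2)]

lemma dirDeriv_congr (h : Set.EqOn v w D.regularSet) :
    Set.EqOn (D.dirDeriv e v) (D.dirDeriv e w) D.regularSet := by
  intro q hq
  rw [dirDeriv_eq hq, dirDeriv_eq hq, fderivWithin_congr h (h hq)]

lemma iterate_dirDeriv_congr (h : Set.EqOn v w D.regularSet) (n : ℕ) :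
    Set.EqOn ((D.dirDeriv e)^[n] v) ((D.dirDeriv e)^[n] w) D.regularSet := by
  induction n generalizing v w with
  | zero => exact h
  | succ _ ih => exact ih (dirDeriv_congr h)

lemma pd_congr (h : Set.EqOn v w D.regularSet) (m n : ℕ) :
    Set.EqOn (D.pd m n v) (D.pd m n w) D.regularSet :=
  iterate_dirDeriv_congr (iterate_dirDeriv_congr h n) m

lemma contDiffOn_dirDeriv {k K : WithTop ℕ∞} (hv : ContDiffOn ℝ K v D.regularSet)
    (hk : k + 1 ≤ K) : ContDiffOn ℝ k (D.dirDeriv e v) D.regularSet :=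
  ((hv.fderivWithin D.uniqueDiffOn_regularSet hk).clm_apply contDiffOn_const).congr
    fun _ hq => dirDeriv_eq hq

lemma contDiffOn_iterate_dirDeriv {k K : ℕ} (n : ℕ) (hv : ContDiffOn ℝ K v D.regularSet)
    (hk : k + n ≤ K) : ContDiffOn ℝ k ((D.dirDeriv e)^[n] v) D.regularSet := by
  induction n generalizing k with
  | zero => exact hv.of_le (by exact_mod_cast hk)
  | succ n ih =>
    rw [Function.iterate_succ_apply']
    exact contDiffOn_dirDeriv (ih (k := k + 1) (by omega)) (by norm_cast)

lemma hasFDerivWithinAt_regular (hv : ContDiffOn ℝ 1 v D.regularSet) (hq : q ∈ D.regularSet) :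
    HasFDerivWithinAt v (fderivWithin ℝ v D.box q) D.box q := by
  have h := ((hv.differentiableOn one_ne_zero) q hq).hasFDerivWithinAt
  rw [regularSet_eq, fderivWithin_inter (D.isOpen_ne_zero.mem_nhds hq.2)] at h
  exact (hasFDerivWithinAt_inter (D.isOpen_ne_zero.mem_nhds hq.2)).1 h

lemma dirDeriv_comm (hv : ContDiffOn ℝ 2 v D.regularSet) :
    Set.EqOn (D.dirDeriv e (D.dirDeriv e' v)) (D.dirDeriv e' (D.dirDeriv e v)) D.regularSet := by
  intro q hq
  have hd : DifferentiableWithinAt ℝ (fderivWithin ℝ v D.regularSet) D.regularSet q :=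
    ((hv.fderivWithin (m := 1) D.uniqueDiffOn_regularSet (by norm_num)).differentiableOn
      one_ne_zero) q hq
  have key : ∀ e e' : ℝ × ℝ, D.dirDeriv e (D.dirDeriv e' v) q
      = fderivWithin ℝ (fderivWithin ℝ v D.regularSet) D.regularSet q e e' := by
    intro e e'
    rw [dirDeriv_eq hq, fderivWithin_congr (fun z hz => dirDeriv_eq hz) (dirDeriv_eq hq),
      fderivWithin_clm_apply (D.uniqueDiffOn_regularSet q hq) hd (differentiableWithinAt_const _)]
    simp
  rw [key, key]
  exact (hv.contDiffWithinAt hq).isSymmSndFDerivWithinAt (by simp)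
    D.uniqueDiffOn_regularSet (D.mem_closure_interior hq) hq e e'

lemma iterate_dirDeriv_comm {n : ℕ} (hv : ContDiffOn ℝ (n + 1 : ℕ) v D.regularSet) :
    Set.EqOn ((D.dirDeriv e)^[n] (D.dirDeriv e' v)) (D.dirDeriv e' ((D.dirDeriv e)^[n] v))
      D.regularSet := by
  induction n generalizing v with
  | zero => exact fun _ _ => rfl
  | succ n ih =>
    rw [Function.iterate_succ_apply, Function.iterate_succ_apply]
    exact (iterate_dirDeriv_congr (dirDeriv_comm (hv.of_le (by norm_cast; omega))) n).trans
      (ih (contDiffOn_dirDeriv hv (by norm_cast)))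

lemma pd_dx {m n : ℕ} (hv : ContDiffOn ℝ (n + 1 : ℕ) v D.regularSet) :
    Set.EqOn (D.pd m n (D.dx v)) (D.pd (m + 1) n v) D.regularSet := by
  rw [pd, pd, Function.iterate_succ_apply]
  exact iterate_dirDeriv_congr (iterate_dirDeriv_comm hv) m

lemma pd_dy (m n : ℕ) (v : ℝ × ℝ → ℝ) : D.pd m n (D.dy v) = D.pd m (n + 1) v := rfl

lemma dirDeriv_add (hv : ContDiffOn ℝ 1 v D.regularSet) (hw : ContDiffOn ℝ 1 w D.regularSet) :
    Set.EqOn (D.dirDeriv e fun z => v z + w z) (fun z => D.dirDeriv e v z + D.dirDeriv e w z)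
      D.regularSet := by
  intro q hq
  rw [dirDeriv, ((hasFDerivWithinAt_regular hv hq).fun_add
    (hasFDerivWithinAt_regular hw hq)).fderivWithin (D.uniqueDiffOn_box q hq.1)]
  rfl

lemma dirDeriv_neg (v : ℝ × ℝ → ℝ) :
    Set.EqOn (D.dirDeriv e fun z => -v z) (fun z => -D.dirDeriv e v z) D.regularSet := by
  intro q hq
  rw [dirDeriv, fderivWithin_fun_neg (D.uniqueDiffOn_box q hq.1)]
  rfl

lemma dirDeriv_mul (hv : ContDiffOn ℝ 1 v D.regularSet) (hw : ContDiffOn ℝ 1 w D.regularSet) :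
    Set.EqOn (D.dirDeriv e fun z => v z * w z)
      (fun z => v z * D.dirDeriv e w z + D.dirDeriv e v z * w z) D.regularSet := by
  intro q hq
  rw [dirDeriv, ((hasFDerivWithinAt_regular hv hq).fun_mul
    (hasFDerivWithinAt_regular hw hq)).fderivWithin (D.uniqueDiffOn_box q hq.1)]
  simp [dirDeriv, mul_comm]

lemma dirDeriv_sum {ι : Type*} (s : Finset ι) (c : ι → ℝ) {v : ι → ℝ × ℝ → ℝ}
    (hv : ∀ i ∈ s, ContDiffOn ℝ 1 (v i) D.regularSet) :
    Set.EqOn (D.dirDeriv e fun z => ∑ i ∈ s, c i * v i z)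
      (fun z => ∑ i ∈ s, c i * D.dirDeriv e (v i) z) D.regularSet := by
  intro q hq
  rw [dirDeriv, (HasFDerivWithinAt.fun_sum fun i hi =>
    (hasFDerivWithinAt_regular (hv i hi) hq).const_mul (c i)).fderivWithin
      (D.uniqueDiffOn_box q hq.1)]
  simp [dirDeriv]

lemma iterate_dirDeriv_add {n : ℕ} (hv : ContDiffOn ℝ n v D.regularSet)
    (hw : ContDiffOn ℝ n w D.regularSet) :
    Set.EqOn ((D.dirDeriv e)^[n] fun z => v z + w z)
      (fun z => (D.dirDeriv e)^[n] v z + (D.dirDeriv e)^[n] w z) D.regularSet := by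
  induction n generalizing v w with
  | zero => exact fun _ _ => rfl
  | succ n ih =>
    have h1 : Set.EqOn _ _ D.regularSet :=
      dirDeriv_add (e := e) (hv.of_le (by norm_cast; omega)) (hw.of_le (by norm_cast; omega))
    simp only [Function.iterate_succ_apply]
    exact (iterate_dirDeriv_congr h1 n).trans
      (ih (contDiffOn_dirDeriv hv (by norm_cast)) (contDiffOn_dirDeriv hw (by norm_cast)))

lemma iterate_dirDeriv_neg (n : ℕ) (v : ℝ × ℝ → ℝ) :
    Set.EqOn ((D.dirDeriv e)^[n] fun z => -v z) (fun z => -(D.dirDeriv e)^[n] v z)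
      D.regularSet := by
  induction n generalizing v with
  | zero => exact fun _ _ => rfl
  | succ n ih =>
    simp only [Function.iterate_succ_apply]
    exact (iterate_dirDeriv_congr (dirDeriv_neg v) n).trans (ih _)

lemma iterate_dirDeriv_sum {ι : Type*} (s : Finset ι) (c : ι → ℝ) {n : ℕ} {v : ι → ℝ × ℝ → ℝ}
    (hv : ∀ i ∈ s, ContDiffOn ℝ n (v i) D.regularSet) :
    Set.EqOn ((D.dirDeriv e)^[n] fun z => ∑ i ∈ s, c i * v i z)
      (fun z => ∑ i ∈ s, c i * (D.dirDeriv e)^[n] (v i) z) D.regularSet := by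
  induction n generalizing v with
  | zero => exact fun _ _ => rfl
  | succ n ih =>
    have h1 : Set.EqOn _ _ D.regularSet :=
      dirDeriv_sum (e := e) s c fun i hi => (hv i hi).of_le (by norm_cast; omega)
    simp only [Function.iterate_succ_apply]
    exact (iterate_dirDeriv_congr h1 n).trans
      (ih fun i hi => contDiffOn_dirDeriv (hv i hi) (by norm_cast))

lemma iterate_dirDeriv_mul {n : ℕ} (hv : ContDiffOn ℝ n v D.regularSet)
    (hw : ContDiffOn ℝ n w D.regularSet) :
    Set.EqOn ((D.dirDeriv e)^[n] fun z => v z * w z)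
      (fun z => ∑ i ∈ range (n + 1),
        (n.choose i : ℝ) * ((D.dirDeriv e)^[i] v z * (D.dirDeriv e)^[n - i] w z))
      D.regularSet := by
  induction n generalizing v w with
  | zero =>
    intro q _
    simp
  | succ n ih =>
    intro q hq
    have hv' : ContDiffOn ℝ n v D.regularSet := hv.of_le (by norm_cast; omega)
    have hw' : ContDiffOn ℝ n w D.regularSet := hw.of_le (by norm_cast; omega)
    have hdv : ContDiffOn ℝ n (D.dirDeriv e v) D.regularSet :=
      contDiffOn_dirDeriv hv (by norm_cast)
    have hdw : ContDiffOn ℝ n (D.dirDeriv e w) D.regularSet :=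
      contDiffOn_dirDeriv hw (by norm_cast)
    have h1 : Set.EqOn _ _ D.regularSet :=
      dirDeriv_mul (e := e) (hv.of_le (by norm_cast; omega)) (hw.of_le (by norm_cast; omega))
    rw [Function.iterate_succ_apply, iterate_dirDeriv_congr h1 n hq,
      iterate_dirDeriv_add (hv'.mul hdw) (hdv.mul hw') hq]
    simp only [ih hv' hdw hq, ih hdv hw' hq]
    rw [sum_choose_succ_mul fun i j => (D.dirDeriv e)^[i] v q * (D.dirDeriv e)^[j] w q]
    congr 1
    refine sum_congr rfl fun i hi => ?_
    rw [mem_range] at hi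
    rw [Nat.succ_sub (by omega), Function.iterate_succ_apply]

lemma pd_add {m n : ℕ} (hv : ContDiffOn ℝ (m + n : ℕ) v D.regularSet)
    (hw : ContDiffOn ℝ (m + n : ℕ) w D.regularSet) :
    Set.EqOn (D.pd m n fun z => v z + w z) (fun z => D.pd m n v z + D.pd m n w z)
      D.regularSet :=
  (iterate_dirDeriv_congr (iterate_dirDeriv_add (hv.of_le (by norm_cast; omega))
    (hw.of_le (by norm_cast; omega))) m).trans
    (iterate_dirDeriv_add (contDiffOn_iterate_dirDeriv n hv le_rfl)
      (contDiffOn_iterate_dirDeriv n hw le_rfl))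

lemma pd_neg (m n : ℕ) (v : ℝ × ℝ → ℝ) :
    Set.EqOn (D.pd m n fun z => -v z) (fun z => -D.pd m n v z) D.regularSet :=
  (iterate_dirDeriv_congr (iterate_dirDeriv_neg n v) m).trans (iterate_dirDeriv_neg m _)

lemma pd_sum {ι : Type*} (s : Finset ι) (c : ι → ℝ) {m n : ℕ} {v : ι → ℝ × ℝ → ℝ}
    (hv : ∀ i ∈ s, ContDiffOn ℝ (m + n : ℕ) (v i) D.regularSet) :
    Set.EqOn (D.pd m n fun z => ∑ i ∈ s, c i * v i z) (fun z => ∑ i ∈ s, c i * D.pd m n (v i) z)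
      D.regularSet :=
  (iterate_dirDeriv_congr (iterate_dirDeriv_sum s c fun i hi =>
    (hv i hi).of_le (by norm_cast; omega)) m).trans
    (iterate_dirDeriv_sum s c fun i hi => contDiffOn_iterate_dirDeriv n (hv i hi) le_rfl)

lemma pd_mul {m n : ℕ} (hv : ContDiffOn ℝ (m + n : ℕ) v D.regularSet)
    (hw : ContDiffOn ℝ (m + n : ℕ) w D.regularSet) :
    Set.EqOn (D.pd m n fun z => v z * w z)
      (fun z => ∑ i ∈ range (m + 1), ∑ j ∈ range (n + 1),
        (m.choose i : ℝ) * (n.choose j : ℝ) * (D.pd i j v z * D.pd (m - i) (n - j) w z))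
      D.regularSet := by
  have hdv : ∀ j ∈ range (n + 1), ContDiffOn ℝ m ((D.dirDeriv (0, 1))^[j] v) D.regularSet :=
    fun j hj => contDiffOn_iterate_dirDeriv j hv (by rw [mem_range] at hj; omega)
  have hdw : ∀ j ∈ range (n + 1), ContDiffOn ℝ m ((D.dirDeriv (0, 1))^[n - j] w) D.regularSet :=
    fun j _ => contDiffOn_iterate_dirDeriv (n - j) hw (by omega)
  have hy : Set.EqOn (D.dy^[n] fun z => v z * w z) _ D.regularSet :=
    iterate_dirDeriv_mul (hv.of_le (by norm_cast; omega)) (hw.of_le (by norm_cast; omega))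
  have hx : Set.EqOn (D.pd m n fun z => v z * w z) _ D.regularSet :=
    (iterate_dirDeriv_congr hy m).trans
      (iterate_dirDeriv_sum _ _ fun j hj => (hdv j hj).mul (hdw j hj))
  intro q hq
  rw [hx hq]
  beta_reduce
  rw [sum_comm]
  refine sum_congr rfl fun j hj => ?_
  rw [iterate_dirDeriv_mul (hdv j hj) (hdw j hj) hq, mul_sum]
  refine sum_congr rfl fun i _ => ?_
  simp only [pd, dx_eq_dirDeriv, dy_eq_dirDeriv]
  ring

end InterfaceDomain

/-! ### Taylor expansion at a point -/

lemma isBigO_pow_succ_of_hasDerivWithinAt {f f' : ℝ → ℝ} {k : ℕ} (h0 : f 0 = 0)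
    (hf : ∀ᶠ t in 𝓝[>] (0 : ℝ), ∀ s ∈ Set.Icc 0 t, HasDerivWithinAt f (f' s) (Set.Icc 0 t) s)
    (hf' : f' =O[𝓝[>] (0 : ℝ)] fun t => t ^ k) :
    f =O[𝓝[>] (0 : ℝ)] fun t => t ^ (k + 1) := by
  obtain ⟨C, hC0, hC⟩ := hf'.exists_nonneg
  obtain ⟨r, hr, hr'⟩ := mem_nhdsGT_iff_exists_Ioo_subset.1 hC.bound
  refine IsBigO.of_bound C ?_
  filter_upwards [Ioo_mem_nhdsGT hr, hf] with t ht hderiv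
  obtain ⟨s, hs, hslope⟩ := exists_hasDerivAt_eq_slope f f' ht.1
    (fun s hs => (hderiv s hs).continuousWithinAt) fun s hs =>
      (hderiv s ⟨hs.1.le, hs.2.le⟩).hasDerivAt (Icc_mem_nhds hs.1 hs.2)
  rw [h0, sub_zero, sub_zero, eq_div_iff ht.1.ne'] at hslope
  calc ‖f t‖ = ‖f' s‖ * ‖t‖ := by rw [← hslope, norm_mul]
    _ ≤ C * ‖s ^ k‖ * ‖t‖ := by gcongr; exact hr' ⟨hs.1, hs.2.trans ht.2⟩
    _ ≤ C * ‖t ^ k‖ * ‖t‖ := by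
      simp only [norm_pow, Real.norm_of_nonneg ht.1.le, Real.norm_of_nonneg hs.1.le]
      have hst := hs.2.le
      have hs0 := hs.1.le
      have ht0 := ht.1.le
      gcongr
    _ = C * ‖t ^ (k + 1)‖ := by rw [pow_succ, norm_mul, mul_assoc]

lemma iteratedDeriv_sub_pow_div_factorial (c : ℝ) (m i : ℕ) :
    iteratedDeriv m (fun t : ℝ => (t - c) ^ i / (i ! : ℝ)) c = if m = i then 1 else 0 := by
  have h := iteratedDeriv_comp_sub_const m (fun t : ℝ => t ^ i / (i ! : ℝ)) c
  rw [h]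
  simp only [sub_self, iteratedDeriv_div_const, iteratedDeriv_fun_pow_zero]
  split_ifs with hmi
  · subst hmi
    exact div_self (by positivity)
  · simp

namespace InterfaceDomain

variable {D : InterfaceDomain} {v w : ℝ × ℝ → ℝ} {p q : ℝ × ℝ}

lemma dirDeriv_eq_dx_dy (e : ℝ × ℝ) (v : ℝ × ℝ → ℝ) (q : ℝ × ℝ) :
    D.dirDeriv e v q = e.1 * D.dx v q + e.2 * D.dy v q := by
  have he : e = e.1 • ((1, 0) : ℝ × ℝ) + e.2 • ((0, 1) : ℝ × ℝ) := by ext <;> simp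
  rw [dirDeriv, he, map_add, map_smul, map_smul]
  simp [dx, dy]

lemma tendsto_add_smul (p e : ℝ × ℝ) :
    Tendsto (fun t : ℝ => p + t • e) (𝓝[>] (0 : ℝ)) (𝓝 p) := by
  have h : Continuous fun t : ℝ => p + t • e := by fun_prop
  simpa using (h.tendsto 0).mono_left nhdsWithin_le_nhds

lemma eventually_mem_regularSet (hp : p ∈ D.regularSet) {e : ℝ × ℝ}
    (he : ∀ᶠ t in 𝓝[>] (0 : ℝ), p + t • e ∈ D.box) :
    ∀ᶠ t in 𝓝[>] (0 : ℝ), ∀ s ∈ Set.Icc 0 t, p + s • e ∈ D.regularSet := by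
  have hψ := (tendsto_add_smul p e).eventually (D.isOpen_ne_zero.mem_nhds hp.2)
  obtain ⟨r, hr, hr'⟩ := mem_nhdsGT_iff_exists_Ioo_subset.1 (he.and hψ)
  filter_upwards [Ioo_mem_nhdsGT hr] with t ht s hs
  rcases hs.1.eq_or_lt with rfl | h
  · simpa using hp
  · exact hr' ⟨h, hs.2.trans_lt ht.2⟩

lemma hasDerivWithinAt_segment (hv : ContDiffOn ℝ 1 v D.regularSet) {e : ℝ × ℝ} {t : ℝ}
    (hseg : ∀ s ∈ Set.Icc 0 t, p + s • e ∈ D.regularSet) {s : ℝ} (hs : s ∈ Set.Icc 0 t) :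
    HasDerivWithinAt (fun s : ℝ => v (p + s • e)) (D.dirDeriv e v (p + s • e)) (Set.Icc 0 t) s := by
  have hline : HasDerivWithinAt (fun s : ℝ => p + s • e) e (Set.Icc 0 t) s := by
    simpa using (((hasDerivAt_id s).smul_const e).const_add p).hasDerivWithinAt
  exact (hasFDerivWithinAt_regular hv (hseg s hs)).comp_hasDerivWithinAt s hline
    fun s hs => (hseg s hs).1

lemma isBigO_of_pd_eq_zero (hp : p ∈ D.regularSet) {e : ℝ × ℝ}
    (he : ∀ᶠ t in 𝓝[>] (0 : ℝ), p + t • e ∈ D.box) {k : ℕ}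
    (hv : ContDiffOn ℝ k v D.regularSet) (h0 : ∀ m n, m + n < k → D.pd m n v p = 0) :
    (fun t : ℝ => v (p + t • e)) =O[𝓝[>] (0 : ℝ)] fun t => t ^ k := by
  have hseg := eventually_mem_regularSet hp he
  induction k generalizing v with
  | zero =>
    have hreg : ∀ᶠ t in 𝓝[>] (0 : ℝ), p + t • e ∈ D.regularSet := by
      filter_upwards [hseg, self_mem_nhdsWithin] with t ht ht0
      exact ht t ⟨le_of_lt ht0, le_rfl⟩
    have hlim : Tendsto (fun t : ℝ => v (p + t • e)) (𝓝[>] (0 : ℝ)) (𝓝 (v p)) :=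
      (hv.continuousOn p hp).tendsto.comp (tendsto_nhdsWithin_iff.2 ⟨tendsto_add_smul p e, hreg⟩)
    simpa using hlim.isBigO_one ℝ
  | succ k ih =>
    have hv1 : ContDiffOn ℝ 1 v D.regularSet := hv.of_le (by norm_cast; omega)
    have hx := ih (v := D.dx v) (contDiffOn_dirDeriv hv (by norm_cast)) fun m n hmn => by
      rw [pd_dx (hv.of_le (by norm_cast; omega)) hp]
      exact h0 _ _ (by omega)
    have hy := ih (v := D.dy v) (contDiffOn_dirDeriv hv (by norm_cast)) fun m n hmn => by
      rw [pd_dy]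
      exact h0 _ _ (by omega)
    have hdir : (fun t : ℝ => D.dirDeriv e v (p + t • e)) =O[𝓝[>] (0 : ℝ)] fun t => t ^ k := by
      simp only [dirDeriv_eq_dx_dy]
      exact (hx.const_mul_left e.1).add (hy.const_mul_left e.2)
    refine isBigO_pow_succ_of_hasDerivWithinAt ?_ ?_ hdir
    · simpa [pd] using h0 0 0 (by omega)
    · exact hseg.mono fun t ht s hs => hasDerivWithinAt_segment hv1 ht hs

lemma dirDeriv_mul_fst_snd {f g : ℝ → ℝ} (hf : ContDiff ℝ 1 f) (hg : ContDiff ℝ 1 g)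
    (hq : q ∈ D.regularSet) (e : ℝ × ℝ) :
    D.dirDeriv e (fun z => f z.1 * g z.2) q
      = e.1 * (deriv f q.1 * g q.2) + e.2 * (f q.1 * deriv g q.2) := by
  have h1 : HasFDerivAt (fun z : ℝ × ℝ => f z.1) (deriv f q.1 • ContinuousLinearMap.fst ℝ ℝ ℝ) q :=
    (hf.differentiable one_ne_zero q.1).hasDerivAt.comp_hasFDerivAt q hasFDerivAt_fst
  have h2 : HasFDerivAt (fun z : ℝ × ℝ => g z.2) (deriv g q.2 • ContinuousLinearMap.snd ℝ ℝ ℝ) q :=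
    (hg.differentiable one_ne_zero q.2).hasDerivAt.comp_hasFDerivAt q hasFDerivAt_snd
  rw [dirDeriv, ((h1.fun_mul h2).hasFDerivWithinAt (s := D.box)).fderivWithin
    (D.uniqueDiffOn_box q hq.1)]
  simp only [add_apply, smul_apply, ContinuousLinearMap.coe_snd', smul_eq_mul,
    ContinuousLinearMap.coe_fst']
  ring

lemma iterate_dx_mul_fst_snd {f g : ℝ → ℝ} (hf : ContDiff ℝ ∞ f) (hg : ContDiff ℝ ∞ g) (m : ℕ) :
    Set.EqOn (D.dx^[m] fun z => f z.1 * g z.2) (fun z => iteratedDeriv m f z.1 * g z.2)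
      D.regularSet := by
  induction m generalizing f with
  | zero => exact fun _ _ => rfl
  | succ m ih =>
    rw [Function.iterate_succ_apply, iteratedDeriv_succ']
    refine (iterate_dirDeriv_congr (fun z hz => ?_) m).trans (ih (contDiff_infty_iff_deriv.1 hf).2)
    rw [dx_eq_dirDeriv, dirDeriv_mul_fst_snd (hf.of_le (by simp)) (hg.of_le (by simp)) hz]
    ring

lemma iterate_dy_mul_fst_snd {f g : ℝ → ℝ} (hf : ContDiff ℝ ∞ f) (hg : ContDiff ℝ ∞ g) (n : ℕ) :
    Set.EqOn (D.dy^[n] fun z => f z.1 * g z.2) (fun z => f z.1 * iteratedDeriv n g z.2)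
      D.regularSet := by
  induction n generalizing g with
  | zero => exact fun _ _ => rfl
  | succ n ih =>
    rw [Function.iterate_succ_apply, iteratedDeriv_succ']
    refine (iterate_dirDeriv_congr (fun z hz => ?_) n).trans (ih (contDiff_infty_iff_deriv.1 hg).2)
    rw [dy_eq_dirDeriv, dirDeriv_mul_fst_snd (hf.of_le (by simp)) (hg.of_le (by simp)) hz]
    ring

lemma pd_mul_fst_snd {f g : ℝ → ℝ} (hf : ContDiff ℝ ∞ f) (hg : ContDiff ℝ ∞ g) (m n : ℕ) :
    Set.EqOn (D.pd m n fun z => f z.1 * g z.2)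
      (fun z => iteratedDeriv m f z.1 * iteratedDeriv n g z.2) D.regularSet := by
  have hg' : ContDiff ℝ ∞ (iteratedDeriv n g) := by
    rw [iteratedDeriv_eq_iterate]
    exact hg.iterate_deriv n
  exact (iterate_dirDeriv_congr (iterate_dy_mul_fst_snd hf hg n) m).trans
    (iterate_dx_mul_fst_snd hf hg' m)

/-- The polynomial of degree at most `N` whose partial derivatives `∂_x^m ∂_y^n` at `p` are
`J m n`. -/
def taylorPoly (J : ℕ → ℕ → ℝ) (N : ℕ) (p q : ℝ × ℝ) : ℝ :=
  taylorSum J N (q.1 - p.1) (q.2 - p.2)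

lemma contDiff_taylorPoly (J : ℕ → ℕ → ℝ) (N : ℕ) (p : ℝ × ℝ) {k : WithTop ℕ∞} :
    ContDiff ℝ k (taylorPoly J N p) := by
  unfold taylorPoly taylorSum
  fun_prop

lemma pd_taylorPoly (J : ℕ → ℕ → ℝ) (hp : p ∈ D.regularSet) {m n N : ℕ} (hmn : m + n ≤ N) :
    D.pd m n (taylorPoly J N p) p = J m n := by
  have hfactor (c : ℝ) (i : ℕ) : ContDiff ℝ ∞ fun t : ℝ => (t - c) ^ i / (i ! : ℝ) := by fun_prop
  have hsum : taylorPoly J N p = fun z => ∑ q ∈ Lam N,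
      J q.1 q.2 * ((z.1 - p.1) ^ q.1 / (q.1 ! : ℝ) * ((z.2 - p.2) ^ q.2 / (q.2 ! : ℝ))) := by
    funext z
    rw [taylorPoly, taylorSum]
    exact sum_congr rfl fun q _ => by rw [div_mul_div_comm]
  rw [hsum, pd_sum _ _ (fun q _ => by fun_prop) hp]
  beta_reduce
  calc ∑ q ∈ Lam N, J q.1 q.2 *
        D.pd m n (fun z => (z.1 - p.1) ^ q.1 / (q.1 ! : ℝ) * ((z.2 - p.2) ^ q.2 / (q.2 ! : ℝ))) p
      = ∑ q ∈ Lam N, if (m, n) = q then J q.1 q.2 else 0 := sum_congr rfl fun q _ => by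
        rw [pd_mul_fst_snd (hfactor _ _) (hfactor _ _) m n hp]
        beta_reduce
        rw [iteratedDeriv_sub_pow_div_factorial, iteratedDeriv_sub_pow_div_factorial]
        simp only [Prod.ext_iff, ite_and, mul_ite, mul_one, mul_zero]
        split_ifs <;> rfl
    _ = J m n := by rw [sum_ite_eq, if_pos (mem_Lam.2 hmn)]

lemma isBigO_sub_taylorSum (hp : p ∈ D.regularSet) {x y : ℝ}
    (he : ∀ᶠ t in 𝓝[>] (0 : ℝ), p + t • (x, y) ∈ D.box) {N : ℕ}
    (hv : ContDiffOn ℝ (N + 1 : ℕ) v D.regularSet) :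
    (fun t : ℝ => v (p + t • (x, y)) - taylorSum (fun m n => D.pd m n v p) N (x * t) (y * t))
      =O[𝓝[>] (0 : ℝ)] fun t => t ^ (N + 1) := by
  set T := taylorPoly (fun m n => D.pd m n v p) N p with hT
  have hTc (k : ℕ) : ContDiffOn ℝ k (fun z => -T z) D.regularSet :=
    (contDiff_taylorPoly _ _ _).neg.contDiffOn
  refine (isBigO_of_pd_eq_zero hp he (v := fun z => v z + -T z) (hv.add (hTc _))
    fun m n hmn => ?_).congr_left fun t => ?_
  · rw [pd_add (hv.of_le (by norm_cast; omega)) (hTc _) hp]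
    beta_reduce
    rw [pd_neg _ _ _ hp]
    beta_reduce
    rw [hT, pd_taylorPoly _ hp (by omega), add_neg_cancel]
  · simp [hT, taylorPoly, sub_eq_add_neg, mul_comm]

end InterfaceDomain

/-! ### Consequences of the differential equation and of the boundary condition -/

lemma eq_zero_of_jetOf_eq {P Q R F : ℕ → ℕ → ℝ} {v w : ℕ → ℝ} {N : ℕ} (hR : R 0 0 ≠ 0)
    (h : ∀ m n, m + n ≤ N + 2 →
      jetOf P Q R F v w m n = jetOf P Q R (fun _ _ => 0) v w m n) (m n : ℕ) (hmn : m + n ≤ N) :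
    F m n = 0 := by
  have hdata : ∀ m n, m + n ≤ N + 2 → jetOf P Q R F (fun _ => 0) (fun _ => 0) m n = 0 := by
    intro m n hmn
    have hadd := jetOf_add (P := P) (Q := Q) (R := R) (F := F) (F' := fun _ _ => 0)
      (v := fun _ => 0) (v' := v) (w := fun _ => 0) (w' := w) m n
    simp only [add_zero, zero_add] at hadd
    linarith [h m n hmn]
  induction hs : m + n using Nat.strong_induction_on generalizing m n with
  | _ s ih =>
    have hstep := jetOf_add_two_of_vanishing m n (fun i j hij => hdata i j (by omega))
      fun i j hij => ih (i + j) (by omega) i j (by omega) rfl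
    rw [hdata _ _ (by omega), hdata _ _ (by omega), hdata _ _ (by omega),
      hdata _ _ (by omega)] at hstep
    simpa [hR] using hstep

namespace InterfaceDomain

variable {D : InterfaceDomain} {a u v f : ℝ × ℝ → ℝ} {β g : ℝ → ℝ} {p : ℝ × ℝ} {x : ℝ}

lemma eq_zero_of_jet_eq {F : ℕ → ℕ → ℝ} {v w : ℕ → ℝ} {N : ℕ} (ha : a p ≠ 0)
    (h : ∀ m n, m + n ≤ N + 2 → D.jet a p F v w m n = D.jet a p (fun _ _ => 0) v w m n) (m n : ℕ)
    (hmn : m + n ≤ N) : F m n = 0 :=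
  eq_zero_of_jetOf_eq (R := fun i j => D.pd i j (fun q => 1 / a q) p) (one_div_ne_zero ha) h m n hmn

lemma contDiffOn_divGrad {k : WithTop ℕ∞} (ha : ContDiffOn ℝ (k + 1) a D.regularSet)
    (hu : ContDiffOn ℝ (k + 1 + 1) u D.regularSet) :
    ContDiffOn ℝ k (D.divGrad a u) D.regularSet :=
  (contDiffOn_dirDeriv (ha.mul (contDiffOn_dirDeriv hu le_rfl)) le_rfl).add
    (contDiffOn_dirDeriv (ha.mul (contDiffOn_dirDeriv hu le_rfl)) le_rfl)

lemma eqOn_neg_divGrad (ha : ContDiffOn ℝ 1 a D.regularSet) (hu : ContDiffOn ℝ 2 u D.regularSet)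
    (hf : ContinuousOn f D.regularSet) (h : ∀ q ∈ D.Ω \ D.interface, -D.divGrad a u q = f q) :
    Set.EqOn (fun q => -D.divGrad a u q) f D.regularSet :=
  Set.EqOn.of_subset_closure h
    (contDiffOn_divGrad (k := 0) (by simpa using ha)
      (by simpa [one_add_one_eq_two] using hu)).continuousOn.neg hf
    D.diff_interface_subset D.regularSet_subset_closure

lemma eqOn_dy_dy (hpos : ∀ q ∈ D.regularSet, 0 < a q) (ha : ContDiffOn ℝ 1 a D.regularSet)
    (hu : ContDiffOn ℝ 2 u D.regularSet)
    (h : Set.EqOn (fun q => -D.divGrad a u q) f D.regularSet) :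
    Set.EqOn (D.dy (D.dy u)) (fun q => -D.dx (D.dx u) q
      + -((D.dx a q / a q) * D.dx u q + ((D.dy a q / a q) * D.dy u q + (1 / a q) * f q)))
      D.regularSet := by
  intro q hq
  have hdu (e : ℝ × ℝ) : ContDiffOn ℝ 1 (D.dirDeriv e u) D.regularSet :=
    contDiffOn_dirDeriv hu (by norm_num)
  have heq := h hq
  have hne := (hpos q hq).ne'
  simp only [divGrad, dx_eq_dirDeriv, dy_eq_dirDeriv] at heq ⊢
  rw [dirDeriv_mul ha (hdu _) hq, dirDeriv_mul ha (hdu _) hq] at heq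
  rw [← heq]
  field_simp
  ring

lemma pd_neg_add_neg_mul {A₁ A₂ A₃ w₁ w₂ w₃ : ℝ × ℝ → ℝ} {m n : ℕ}
    (hv : ContDiffOn ℝ (m + n : ℕ) v D.regularSet)
    (hA₁ : ContDiffOn ℝ (m + n : ℕ) A₁ D.regularSet)
    (hA₂ : ContDiffOn ℝ (m + n : ℕ) A₂ D.regularSet)
    (hA₃ : ContDiffOn ℝ (m + n : ℕ) A₃ D.regularSet)
    (hw₁ : ContDiffOn ℝ (m + n : ℕ) w₁ D.regularSet)
    (hw₂ : ContDiffOn ℝ (m + n : ℕ) w₂ D.regularSet)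
    (hw₃ : ContDiffOn ℝ (m + n : ℕ) w₃ D.regularSet) (hp : p ∈ D.regularSet) :
    D.pd m n (fun q => -v q + -(A₁ q * w₁ q + (A₂ q * w₂ q + A₃ q * w₃ q))) p = -D.pd m n v p
      - ∑ i ∈ range (m + 1), ∑ j ∈ range (n + 1), (m.choose i : ℝ) * (n.choose j : ℝ) *
          (D.pd i j A₁ p * D.pd (m - i) (n - j) w₁ p + D.pd i j A₂ p * D.pd (m - i) (n - j) w₂ p
            + D.pd i j A₃ p * D.pd (m - i) (n - j) w₃ p) := by
  have h₁ := hA₁.mul hw₁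
  have h₂ := hA₂.mul hw₂
  have h₃ := hA₃.mul hw₃
  rw [pd_add hv.neg (h₁.add (h₂.add h₃)).neg hp]
  beta_reduce
  rw [pd_neg _ _ _ hp, pd_neg _ _ _ hp, ← sub_eq_add_neg]
  beta_reduce
  rw [pd_add h₁ (h₂.add h₃) hp]
  beta_reduce
  rw [pd_add h₂ h₃ hp, pd_mul hA₁ hw₁ hp]
  beta_reduce
  rw [pd_mul hA₂ hw₂ hp, pd_mul hA₃ hw₃ hp]
  simp only [← sum_add_distrib, mul_add, add_assoc]

lemma pd_add_two_right {m n K : ℕ} (hpos : ∀ q ∈ D.regularSet, 0 < a q)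
    (ha : ContDiffOn ℝ (K + 1 : ℕ) a D.regularSet) (hu : ContDiffOn ℝ (K + 2 : ℕ) u D.regularSet)
    (hf : ContDiffOn ℝ K f D.regularSet)
    (h : Set.EqOn (fun q => -D.divGrad a u q) f D.regularSet) (hp : p ∈ D.regularSet)
    (hmn : m + n ≤ K) :
    D.pd m (n + 2) u p = -D.pd (m + 2) n u p
      - ∑ i ∈ range (m + 1), ∑ j ∈ range (n + 1), (m.choose i : ℝ) * (n.choose j : ℝ) *
          (D.pd i j (fun q => D.dx a q / a q) p * D.pd (m - i + 1) (n - j) u p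
            + D.pd i j (fun q => D.dy a q / a q) p * D.pd (m - i) (n - j + 1) u p
            + D.pd i j (fun q => 1 / a q) p * D.pd (m - i) (n - j) f p) := by
  have hne : ∀ q ∈ D.regularSet, a q ≠ 0 := fun q hq => (hpos q hq).ne'
  have hle : ((m + n : ℕ) : WithTop ℕ∞) ≤ (K : ℕ) := by norm_cast
  have haK : ContDiffOn ℝ K a D.regularSet := ha.of_le (by norm_cast; omega)
  have hdu (e : ℝ × ℝ) : ContDiffOn ℝ (K + 1 : ℕ) (D.dirDeriv e u) D.regularSet :=
    contDiffOn_dirDeriv hu (by norm_cast)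
  have hdu' (e : ℝ × ℝ) : ContDiffOn ℝ (m + n : ℕ) (D.dirDeriv e u) D.regularSet :=
    (hdu e).of_le (by norm_cast; omega)
  have hddu (e : ℝ × ℝ) :
      ContDiffOn ℝ (m + n : ℕ) (D.dirDeriv e (D.dirDeriv e u)) D.regularSet :=
    (contDiffOn_dirDeriv (hdu e) (by norm_cast)).of_le hle
  have hda (e : ℝ × ℝ) : ContDiffOn ℝ (m + n : ℕ) (fun q => D.dirDeriv e a q / a q) D.regularSet :=
    ((contDiffOn_dirDeriv ha (by norm_cast)).div haK hne).of_le hle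
  have hinv : ContDiffOn ℝ (m + n : ℕ) (fun q => 1 / a q) D.regularSet :=
    (contDiffOn_const.div haK hne).of_le hle
  have hdxdx : D.pd m n (D.dx (D.dx u)) p = D.pd (m + 2) n u p := by
    rw [pd_dx (v := D.dx u) ((hdu _).of_le (by norm_cast; omega)) hp,
      pd_dx (hu.of_le (by norm_cast; omega)) hp]
  have hdx (i : ℕ) {j : ℕ} (hj : j ≤ n) : D.pd i j (D.dx u) p = D.pd (i + 1) j u p :=
    pd_dx (hu.of_le (by norm_cast; omega)) hp
  rw [← pd_dy, ← pd_dy, pd_congr (eqOn_dy_dy hpos (ha.of_le (by norm_cast; omega))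
    (hu.of_le (by norm_cast; omega)) h) m n hp,
    pd_neg_add_neg_mul (v := D.dx (D.dx u)) (A₁ := fun q => D.dx a q / a q)
      (A₂ := fun q => D.dy a q / a q) (w₁ := D.dx u) (w₂ := D.dy u)
      (hddu _) (hda _) (hda _) hinv (hdu' _) (hdu' _) (hf.of_le hle) hp, hdxdx]
  simp only [hdx _ (Nat.sub_le n _), pd_dy]

lemma pd_eq_jet {K : ℕ} (hpos : ∀ q ∈ D.regularSet, 0 < a q)
    (ha : ContDiffOn ℝ (K + 1 : ℕ) a D.regularSet) (hu : ContDiffOn ℝ (K + 2 : ℕ) u D.regularSet)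
    (hf : ContDiffOn ℝ K f D.regularSet)
    (h : Set.EqOn (fun q => -D.divGrad a u q) f D.regularSet) (hp : p ∈ D.regularSet)
    (m n : ℕ) (hmn : m + n ≤ K + 2) :
    D.pd m n u p = D.jet a p (fun i j => D.pd i j f p) (fun i => D.pd i 0 u p)
      (fun i => D.pd i 1 u p) m n := by
  induction n using Nat.strong_induction_on generalizing m with
  | _ n ih =>
    match n with
    | 0 => rw [jet, jetOf_zero_right]
    | 1 => rw [jet, jetOf_one_right]
    | n + 2 =>
      rw [pd_add_two_right hpos ha hu hf h hp (by omega), ih n (by omega) (m + 2) (by omega)]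
      conv_rhs => rw [jet, jetOf]
      congr 1
      refine sum_congr rfl fun i hi => sum_congr rfl fun j hj => ?_
      rw [mem_range] at hi hj
      rw [ih (n - j) (by omega) _ (by omega), ih (n - j + 1) (by omega) _ (by omega)]
      rfl

lemma isOpen_regularTop : IsOpen D.regularTop :=
  isOpen_Ioo.inter (D.isOpen_ne_zero.preimage (f := fun x => (x, D.l₄)) (by fun_prop))

lemma mem_regularSet_of_mem_regularTop (hx : x ∈ D.regularTop) : (x, D.l₄) ∈ D.regularSet :=
  ⟨⟨⟨hx.1.1.le, hx.1.2.le⟩, ⟨D.lt₃₄.le, le_rfl⟩⟩, hx.2⟩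

lemma hasDerivAt_top (hv : ContDiffOn ℝ 1 v D.regularSet) (hx : x ∈ D.regularTop) :
    HasDerivAt (fun t => v (t, D.l₄)) (D.dx v (x, D.l₄)) x := by
  have hline : HasDerivWithinAt (fun t : ℝ => (t, D.l₄)) ((1 : ℝ), (0 : ℝ))
      (Set.Icc D.l₁ D.l₂) x :=
    ((hasDerivAt_id x).prodMk (hasDerivAt_const _ _)).hasDerivWithinAt
  have hmaps : Set.MapsTo (fun t : ℝ => (t, D.l₄)) (Set.Icc D.l₁ D.l₂) D.box :=
    fun t ht => ⟨ht, D.lt₃₄.le, le_rfl⟩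
  exact ((hasFDerivWithinAt_regular hv (mem_regularSet_of_mem_regularTop hx)).comp_hasDerivWithinAt
    x hline hmaps).hasDerivAt (Icc_mem_nhds hx.1.1 hx.1.2)

lemma iteratedDeriv_top {n : ℕ} (hv : ContDiffOn ℝ n v D.regularSet) (hx : x ∈ D.regularTop) :
    iteratedDeriv n (fun t => v (t, D.l₄)) x = D.pd n 0 v (x, D.l₄) := by
  induction n generalizing v with
  | zero => rw [iteratedDeriv_zero]; rfl
  | succ n ih =>
    have hderiv : deriv (fun t => v (t, D.l₄)) =ᶠ[𝓝 x] fun t => D.dx v (t, D.l₄) := by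
      filter_upwards [isOpen_regularTop.mem_nhds hx] with t ht
      exact (hasDerivAt_top (hv.of_le (by norm_cast; omega)) ht).deriv
    rw [iteratedDeriv_succ', hderiv.iteratedDeriv_eq,
      ih (v := D.dx v) (contDiffOn_dirDeriv hv (by norm_cast))]
    rfl

lemma contDiffOn_top {k : WithTop ℕ∞} (hv : ContDiffOn ℝ k v D.regularSet) :
    ContDiffOn ℝ k (fun t => v (t, D.l₄)) D.regularTop :=
  hv.comp (f := fun t : ℝ => (t, D.l₄)) (by fun_prop)
    fun _ ht => mem_regularSet_of_mem_regularTop ht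

lemma iteratedDeriv_robin {n : ℕ} (hu : ContDiffOn ℝ (n + 1 : ℕ) u D.regularSet)
    (hβ : ContDiffOn ℝ n β D.regularTop)
    (h : ∀ x ∈ D.regularTop, D.dy u (x, D.l₄) + β x * u (x, D.l₄) = g x) (hx : x ∈ D.regularTop) :
    iteratedDeriv n g x = D.pd n 1 u (x, D.l₄) + ∑ i ∈ range (n + 1),
      (n.choose i : ℝ) * iteratedDeriv (n - i) β x * D.pd i 0 u (x, D.l₄) := by
  have hun : ContDiffOn ℝ n u D.regularSet := hu.of_le (by norm_cast; omega)
  have huy : ContDiffOn ℝ n (D.dy u) D.regularSet := contDiffOn_dirDeriv hu (by norm_cast)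
  have hmem := isOpen_regularTop.mem_nhds hx
  have hg : g =ᶠ[𝓝 x] fun t => D.dy u (t, D.l₄) + u (t, D.l₄) * β t := by
    filter_upwards [hmem] with t ht
    rw [← h t ht, mul_comm]
  have huat := (contDiffOn_top hun).contDiffAt hmem
  have huyat := (contDiffOn_top huy).contDiffAt hmem
  have hβat := hβ.contDiffAt hmem
  rw [hg.iteratedDeriv_eq, iteratedDeriv_fun_add huyat (huat.mul hβat), iteratedDeriv_top huy hx,
    iteratedDeriv_fun_mul huat hβat]
  congr 1
  refine sum_congr rfl fun i hi => ?_
  rw [iteratedDeriv_top (hun.of_le (by exact_mod_cast mem_range_succ_iff.1 hi)) hx,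
    mul_right_comm]

end InterfaceDomain

/-! ### Accuracy of six-point schemes -/

namespace InterfaceDomain

variable {D : InterfaceDomain} {a u v f : ℝ × ℝ → ℝ} {β g : ℝ → ℝ} {x₀ : ℝ}

lemma eventually_mem_box (hx₀ : x₀ ∈ Set.Ioo D.l₁ D.l₂) (x : ℝ) {y : ℝ} (hy : y ≤ 0) :
    ∀ᶠ t in 𝓝[>] (0 : ℝ), (x₀, D.l₄) + t • (x, y) ∈ D.box := by
  have hmem : Set.Icc D.l₁ D.l₂ ×ˢ Set.Ioi D.l₃ ∈ 𝓝 (x₀, D.l₄) :=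
    prod_mem_nhds (Icc_mem_nhds hx₀.1 hx₀.2) (Ioi_mem_nhds D.lt₃₄)
  filter_upwards [(tendsto_add_smul (x₀, D.l₄) (x, y)).eventually hmem, self_mem_nhdsWithin]
    with t ht ht0
  exact ⟨ht.1, le_of_lt ht.2,
    add_le_of_nonpos_right (mul_nonpos_of_nonneg_of_nonpos (le_of_lt ht0) hy)⟩

lemma isBigO_sub_taylorSum_stencil (hx₀ : x₀ ∈ D.regularTop) {N : ℕ}
    (hv : ContDiffOn ℝ (N + 1 : ℕ) v D.regularSet) (k : ℤ) {l : ℤ} (hl : l ∈ Icc (-1 : ℤ) 0) :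
    (fun t : ℝ => v (x₀ + k * t, D.l₄ + l * t)
      - taylorSum (fun m n => D.pd m n v (x₀, D.l₄)) N (k * t) (l * t))
      =O[𝓝[>] (0 : ℝ)] fun t => t ^ (N + 1) := by
  have hl0 : (l : ℝ) ≤ 0 := by exact_mod_cast (mem_Icc.1 hl).2
  refine (isBigO_sub_taylorSum (mem_regularSet_of_mem_regularTop hx₀)
    (eventually_mem_box hx₀.1 k hl0) hv).congr_left fun t => ?_
  rw [Prod.smul_mk, Prod.mk_add_mk, smul_eq_mul, smul_eq_mul, mul_comm t, mul_comm t]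

lemma IsCoefficients.mono {ka kb ka' kb' : WithTop ℕ∞} (h : D.IsCoefficients ka kb a β)
    (ha : ka' ≤ ka) (hb : kb' ≤ kb) : D.IsCoefficients ka' kb' a β :=
  ⟨h.pos, h.contDiff_a.of_le ha, h.contDiff_β.of_le hb⟩

lemma IsSolution.mono {ku kf kg ku' kf' kg' : WithTop ℕ∞}
    (h : D.IsSolution a β ku kf kg u f g) (hu : ku' ≤ ku) (hf : kf' ≤ kf) (hg : kg' ≤ kg) :
    D.IsSolution a β ku' kf' kg' u f g :=
  ⟨h.contDiff_u.of_le hu, h.contDiff_f.of_le hf, h.contDiff_g.of_le hg, h.pde, h.robin⟩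

lemma IsSolution.taylorSum_eq {N : ℕ} {kg : WithTop ℕ∞}
    (hs : D.IsSolution a β (N + 2 : ℕ) N kg u f g)
    (hab : D.IsCoefficients (N + 1 : ℕ) (N + 1 : ℕ) a β) (hx₀ : x₀ ∈ D.regularTop) (x y : ℝ) :
    taylorSum (fun m n => D.pd m n u (x₀, D.l₄)) (N + 2) x y
      = ∑ n ∈ range (N + 3), D.pd n 0 u (x₀, D.l₄) *
          taylorSum (D.robinJet a (x₀, D.l₄) (fun i => iteratedDeriv i β x₀) n) (N + 2) x y
        + (∑ q ∈ Lam N, D.pd q.1 q.2 f (x₀, D.l₄) * D.QH a (x₀, D.l₄) (N + 1) q.1 q.2 x y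
          + ∑ n ∈ range (N + 2), iteratedDeriv n g x₀ * D.GH a (x₀, D.l₄) (N + 1) n 1 x y) := by
  have hpde := eqOn_neg_divGrad (hab.contDiff_a.of_le (by norm_cast; omega))
    (hs.contDiff_u.of_le (by norm_cast; omega)) hs.contDiff_f.continuousOn hs.pde
  rw [← D.taylorSum_jet_robin a _ (fun i => iteratedDeriv i β x₀) fun i j =>
    D.pd i j f (x₀, D.l₄)]
  refine sum_congr rfl fun q hq => congrArg (· * _) ?_
  rw [mem_Lam] at hq
  beta_reduce
  rw [pd_eq_jet hab.pos hab.contDiff_a hs.contDiff_u hs.contDiff_f hpde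
    (mem_regularSet_of_mem_regularTop hx₀) _ _ hq]
  refine jetOf_congr _ _ (fun _ _ _ => rfl) (fun _ _ => rfl) fun i hi => ?_
  rw [iteratedDeriv_robin (hs.contDiff_u.of_le (by norm_cast; omega))
    (hab.contDiff_β.of_le (by norm_cast; omega)) hs.robin hx₀, add_sub_cancel_right]

lemma solvesSystem_iff (c : ℤ → ℤ → ℕ → ℝ) :
    SolvesSystem D x₀ a β c ↔ ∀ n ≤ 6, (fun h : ℝ => stencilSum fun k l => polyCoeff c k l h *
      taylorSum (D.robinJet a (x₀, D.l₄) (fun i => iteratedDeriv i β x₀) n) 6 (k * h) (l * h))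
        =O[𝓝[>] (0 : ℝ)] fun h => h ^ 7 := by
  have hsum (n : ℕ) (x y : ℝ) : ∑ i ∈ Icc n 5, (i.choose n : ℝ) * iteratedDeriv (i - n) β x₀ *
        D.GH a (x₀, D.l₄) 5 i 1 x y * (1 - if n = 6 then 1 else 0)
      = ∑ i ∈ Icc n 5, (i.choose n : ℝ) * iteratedDeriv (i - n) β x₀ *
        D.GH a (x₀, D.l₄) 5 i 1 x y := by
    refine sum_congr rfl fun i hi => ?_
    have hi' := mem_Icc.1 hi
    rw [if_neg (by omega), sub_zero, mul_one]
  have hrange (n : ℕ) : n ∈ range 7 ↔ n ≤ 6 := mem_range_succ_iff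
  simp only [SolvesSystem, hrange, hsum]
  refine forall₂_congr fun n hn => ?_
  simp only [D.taylorSum_robinJet (N := 4) a _ _ hn, Nat.reduceAdd]

lemma exists_solvesSystem : ∃ c, SolvesSystem D x₀ a β c ∧ IsNontrivial c := by
  obtain ⟨c, hnontrivial, hc⟩ := exists_stencil_of_isRobinFamily
    (D.isRobinFamily_robinJet a (x₀, D.l₄) fun i => iteratedDeriv i β x₀)
  exact ⟨c, (solvesSystem_iff c).2 hc, hnontrivial⟩

end InterfaceDomain

namespace SixPointScheme

variable {S : SixPointScheme} {D : InterfaceDomain} {a u f : ℝ × ℝ → ℝ} {β g : ℝ → ℝ}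
  {x₀ : ℝ}

lemma IsConsistent.mono {P : ℕ} {ku kf kg ku' kf' kg' : WithTop ℕ∞}
    (h : S.IsConsistent D x₀ a β ku kf kg P) (hu : ku ≤ ku') (hf : kf ≤ kf') (hg : kg ≤ kg') :
    S.IsConsistent D x₀ a β ku' kf' kg' P :=
  fun _ _ _ hs => h _ _ _ (hs.mono hu hf hg)

lemma residual_eq_stencilSum (hf : ∀ i j, i + j ≤ S.ordF → D.pd i j f (x₀, D.l₄) = 0)
    (hg : ∀ i ≤ S.ordG, iteratedDeriv i g x₀ = 0) (h : ℝ) :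
    S.residual D x₀ u f g h
      = stencilSum fun k l => S.C k l h * u (x₀ + k * h, D.l₄ + l * h) := by
  rw [SixPointScheme.residual, sum_eq_zero, sum_eq_zero, add_zero, sub_zero]
  · intro i hi
    rw [hg i (mem_range_succ_iff.1 hi), zero_mul]
  · intro q hq
    rw [hf _ _ (mem_Lam.1 hq), zero_mul]

end SixPointScheme

lemma continuous_polyCoeff (c : ℤ → ℤ → ℕ → ℝ) (k l : ℤ) : Continuous (polyCoeff c k l) := by
  unfold polyCoeff
  fun_prop

lemma polyCoeff_zero (c : ℤ → ℤ → ℕ → ℝ) (k l : ℤ) : polyCoeff c k l 0 = c k l 0 := by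
  simp [polyCoeff, sum_range_succ']

namespace InterfaceDomain

variable {D : InterfaceDomain} {a u f : ℝ × ℝ → ℝ} {β g : ℝ → ℝ} {x₀ : ℝ}

lemma isNormalized_robinScheme {c : ℤ → ℤ → ℕ → ℝ} (hc : IsNontrivial c) :
    (robinScheme D x₀ a c).IsNormalized := by
  obtain ⟨k, hk, l, hl, hkl⟩ := hc
  have hlim : Tendsto (fun h => |polyCoeff c k l h|) (𝓝[>] 0) (𝓝 |c k l 0|) := by
    rw [← polyCoeff_zero c]
    exact (continuous_polyCoeff c k l).abs.continuousAt.mono_left nhdsWithin_le_nhds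
  refine ⟨|c k l 0| / 2, half_pos (abs_pos.2 hkl), ?_⟩
  filter_upwards [hlim.eventually (lt_mem_nhds (half_lt_self (abs_pos.2 hkl)))] with h hh
  exact hh.le.trans (abs_le_stencilSum_abs (fun k l => polyCoeff c k l h) hk hl)

lemma residual_robinScheme (hs : D.IsSolution a β 6 4 0 u f g) (hab : D.IsCoefficients 5 5 a β)
    (hx₀ : x₀ ∈ D.regularTop) (c : ℤ → ℤ → ℕ → ℝ) (h : ℝ) :
    (robinScheme D x₀ a c).residual D x₀ u f g h
      = (stencilSum fun k l => polyCoeff c k l h * (u (x₀ + k * h, D.l₄ + l * h)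
          - taylorSum (fun m n => D.pd m n u (x₀, D.l₄)) 6 (k * h) (l * h)))
        + ∑ n ∈ range 7, D.pd n 0 u (x₀, D.l₄) * stencilSum fun k l => polyCoeff c k l h *
          taylorSum (D.robinJet a (x₀, D.l₄) (fun i => iteratedDeriv i β x₀) n) 6
            (k * h) (l * h) := by
  simp only [SixPointScheme.residual, robinScheme, hs.taylorSum_eq (N := 4) hab hx₀,
    ← stencilSum_mul_left, ← stencilSum_sum, ← stencilSum_add, ← stencilSum_sub, Nat.reduceAdd]
  congr 1
  ext k l
  simp only [mul_sub, mul_add, mul_sum, mul_left_comm (polyCoeff c k l h)]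
  ring

lemma isConsistent_robinScheme (hx₀ : x₀ ∈ D.regularTop) (hab : D.IsCoefficients 5 5 a β)
    {c : ℤ → ℤ → ℕ → ℝ} (hc : SolvesSystem D x₀ a β c) :
    (robinScheme D x₀ a c).IsConsistent D x₀ a β 7 4 0 6 := by
  intro u f g hs
  have hbounded (k l : ℤ) : polyCoeff c k l =O[𝓝[>] (0 : ℝ)] fun _ => (1 : ℝ) :=
    ((continuous_polyCoeff c k l).continuousAt.mono_left nhdsWithin_le_nhds).isBigO_one ℝ
  have hremainder : (fun h : ℝ => stencilSum fun k l => polyCoeff c k l h *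
      (u (x₀ + k * h, D.l₄ + l * h)
        - taylorSum (fun m n => D.pd m n u (x₀, D.l₄)) 6 (k * h) (l * h)))
      =O[𝓝[>] (0 : ℝ)] fun h => h ^ 7 :=
    isBigO_stencilSum fun k _ l hl => by
      simpa only [one_mul] using (hbounded k l).mul
        (isBigO_sub_taylorSum_stencil hx₀ hs.contDiff_u k hl)
  have hsystem : (fun h : ℝ => ∑ n ∈ range 7, D.pd n 0 u (x₀, D.l₄) * stencilSum fun k l =>
      polyCoeff c k l h * taylorSum (D.robinJet a (x₀, D.l₄) (fun i => iteratedDeriv i β x₀) n) 6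
        (k * h) (l * h)) =O[𝓝[>] (0 : ℝ)] fun h => h ^ 7 :=
    IsBigO.fun_sum fun n hn =>
      ((solvesSystem_iff c).1 hc n (mem_range_succ_iff.1 hn)).const_mul_left _
  exact (hremainder.add hsystem).congr_left fun h =>
    (residual_robinScheme (hs.mono (by norm_num) le_rfl le_rfl) hab hx₀ c h).symm

lemma exists_hasAccuracyOrder_six (hx₀ : x₀ ∈ D.regularTop) (hab : D.IsCoefficients ∞ ∞ a β) :
    ∃ S : SixPointScheme, S.HasAccuracyOrder D x₀ a β ∞ ∞ ∞ 6 := by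
  have hle (k : ℕ) : (k : WithTop ℕ∞) ≤ ∞ := by exact_mod_cast le_top
  obtain ⟨c, hc, hnontrivial⟩ := exists_solvesSystem (D := D) (x₀ := x₀) (a := a) (β := β)
  exact ⟨robinScheme D x₀ a c, isNormalized_robinScheme hnontrivial,
    (isConsistent_robinScheme hx₀ (hab.mono (hle 5) (hle 5)) hc).mono (hle 7) (hle 4) (hle 0)⟩

lemma pd_neg_divGrad_eq_zero {b : ℕ → ℝ} {p : ℝ × ℝ} {n N : ℕ}
    (hpos : ∀ q ∈ D.regularSet, 0 < a q) (ha : ContDiffOn ℝ (N + 1 : ℕ) a D.regularSet)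
    (hu : ContDiffOn ℝ (N + 2 : ℕ) u D.regularSet) (hp : p ∈ D.regularSet)
    (hjet : ∀ i j, i + j ≤ N + 2 → D.pd i j u p = D.robinJet a p b n i j) {i j : ℕ}
    (hij : i + j ≤ N) : D.pd i j (fun q => -D.divGrad a u q) p = 0 := by
  have hf : ContDiffOn ℝ N (fun q => -D.divGrad a u q) D.regularSet :=
    (contDiffOn_divGrad ha hu).neg
  refine eq_zero_of_jet_eq (D := D) (F := fun i j => D.pd i j (fun q => -D.divGrad a u q) p)
    (v := fun i => D.pd i 0 u p) (w := fun i => D.pd i 1 u p) (hpos p hp).ne'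
    (fun i j hij => ?_) i j hij
  refine (pd_eq_jet hpos ha hu hf (fun _ _ => rfl) hp i j hij).symm.trans ((hjet i j hij).trans ?_)
  refine jetOf_congr _ _ (fun _ _ _ => rfl) (fun m hm => ?_) fun m hm => ?_
  · rw [hjet m 0 (by omega), robinJet_zero_right]
  · rw [hjet m 1 (by omega), robinJet_one_right]

lemma iteratedDeriv_robin_eq_zero {n i : ℕ} (hx₀ : x₀ ∈ D.regularTop)
    (hu : ContDiffOn ℝ (i + 1 : ℕ) u D.regularSet) (hβ : ContDiffOn ℝ i β D.regularTop)
    (hjet : ∀ m j, m + j ≤ i + 1 → D.pd m j u (x₀, D.l₄)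
      = D.robinJet a (x₀, D.l₄) (fun i => iteratedDeriv i β x₀) n m j) :
    iteratedDeriv i (fun x => D.dy u (x, D.l₄) + β x * u (x, D.l₄)) x₀ = 0 := by
  have hboundary : ∀ m ∈ range (i + 1),
      (i.choose m : ℝ) * iteratedDeriv (i - m) β x₀ * D.pd m 0 u (x₀, D.l₄)
        = if m = n then (i.choose n : ℝ) * iteratedDeriv (i - n) β x₀ else 0 := fun m hm => by
    rw [mem_range] at hm
    rw [hjet m 0 (by omega), robinJet_zero_right]
    split_ifs with h
    · rw [h, mul_one]
    · rw [mul_zero]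
  rw [iteratedDeriv_robin hu hβ (fun _ _ => rfl) hx₀, hjet i 1 le_rfl, robinJet_one_right,
    sum_congr rfl hboundary, sum_ite_eq']
  split_ifs with h
  · exact neg_add_cancel _
  · rw [mem_range_succ_iff, not_le] at h
    rw [Nat.choose_eq_zero_of_lt h, Nat.cast_zero, zero_mul, neg_zero, add_zero]

lemma exists_solution_with_robinJet (hx₀ : x₀ ∈ D.regularTop) (hab : D.IsCoefficients ∞ ∞ a β)
    (n N : ℕ) :
    ∃ u f g, D.IsSolution a β ∞ ∞ ∞ u f g ∧
      (∀ i j, i + j ≤ N + 2 → D.pd i j u (x₀, D.l₄)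
        = D.robinJet a (x₀, D.l₄) (fun i => iteratedDeriv i β x₀) n i j) ∧
      (∀ i j, i + j ≤ N → D.pd i j f (x₀, D.l₄) = 0) ∧
      ∀ i ≤ N, iteratedDeriv i g x₀ = 0 := by
  have hp := mem_regularSet_of_mem_regularTop hx₀
  have hle (k : ℕ) : (k : WithTop ℕ∞) ≤ ∞ := by exact_mod_cast le_top
  set J := D.robinJet a (x₀, D.l₄) (fun i => iteratedDeriv i β x₀) n
  set u := taylorPoly J (N + 2) (x₀, D.l₄)
  have hu (k : WithTop ℕ∞) : ContDiffOn ℝ k u D.regularSet :=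
    (contDiff_taylorPoly _ _ _).contDiffOn
  have hjet : ∀ i j, i + j ≤ N + 2 → D.pd i j u (x₀, D.l₄) = J i j := fun i j hij =>
    pd_taylorPoly _ hp hij
  refine ⟨u, fun q => -D.divGrad a u q, fun x => D.dy u (x, D.l₄) + β x * u (x, D.l₄),
    ⟨hu _, (contDiffOn_divGrad hab.contDiff_a (hu _)).neg, ?_, fun _ _ => rfl, fun _ _ => rfl⟩,
    hjet, fun i j hij => ?_, fun i hi => ?_⟩
  · exact (contDiffOn_top (contDiffOn_dirDeriv (hu (∞ + 1)) le_rfl)).add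
      (hab.contDiff_β.mul (contDiffOn_top (hu ∞)))
  · exact pd_neg_divGrad_eq_zero hab.pos (hab.contDiff_a.of_le (hle _)) (hu _) hp hjet hij
  · exact iteratedDeriv_robin_eq_zero hx₀ (hu _) (hab.contDiff_β.of_le (hle _)) fun m j hmj =>
      hjet m j (by omega)

lemma isRobinExpansion_of_pd_eq {v : ℝ × ℝ → ℝ} {b P Q : ℝ} {J : ℕ → ℕ → ℕ → ℝ}
    (hJ : IsRobinFamily b P Q J) {n : ℕ} (hx₀ : x₀ ∈ D.regularTop)
    (hv : ContDiffOn ℝ (n + 2 : ℕ) v D.regularSet)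
    (hjet : ∀ i j, i + j ≤ n + 1 → D.pd i j v (x₀, D.l₄) = J n i j) :
    IsRobinExpansion b P Q n fun k l h => v (x₀ + k * h, D.l₄ + l * h) := by
  intro k _ l hl
  have hpart : ∀ d ≤ n + 1, homPart (fun i j => D.pd i j v (x₀, D.l₄)) d = homPart (J n) d :=
    fun d hd => homPart_congr fun i j hij => hjet i j (hij.le.trans hd)
  refine (isBigO_sub_taylorSum_stencil hx₀ hv k hl).congr_left fun h => congrArg _ ?_
  rw [taylorSum_mul, sum_range_succ, sum_range_succ, sum_eq_zero, zero_add,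
    hpart n n.le_succ, hpart (n + 1) le_rfl, hJ.homPart_self, hJ.homPart_succ]
  intro d hd
  rw [mem_range] at hd
  rw [hpart d (by omega), hJ.homPart_of_lt hd, mul_zero]

lemma le_six_of_hasAccuracyOrder (hx₀ : x₀ ∈ D.regularTop) (hab : D.IsCoefficients ∞ ∞ a β)
    (hne : 2 * a (x₀, D.l₄) * β x₀ ≠ D.dy a (x₀, D.l₄)) {S : SixPointScheme} {P : ℕ}
    (hS : S.HasAccuracyOrder D x₀ a β ∞ ∞ ∞ P) : P ≤ 6 := by
  by_contra! hP
  have hle (k : ℕ) : (k : WithTop ℕ∞) ≤ ∞ := by exact_mod_cast le_top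
  obtain ⟨⟨δ, hδ, hnorm⟩, hcons⟩ := hS
  choose u f g hsol hu hf hg using fun n =>
    exists_solution_with_robinJet hx₀ hab n (S.ordF + S.ordG + 6)
  have hfamily := D.isRobinFamily_robinJet a (x₀, D.l₄) fun i => iteratedDeriv i β x₀
  have hgeneral : 2 * iteratedDeriv 0 β x₀ ≠ D.dy a (x₀, D.l₄) / a (x₀, D.l₄) := by
    have hpos := hab.pos _ (mem_regularSet_of_mem_regularTop hx₀)
    rwa [iteratedDeriv_zero, ne_eq, eq_div_iff hpos.ne', mul_right_comm]
  refine false_of_isRobinExpansion hgeneral hδ hnorm (fun n hn => isRobinExpansion_of_pd_eq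
    hfamily hx₀ ((hsol n).contDiff_u.of_le (hle _)) fun i j hij => hu n i j (by omega))
    fun n _ => ?_
  refine ((hcons _ _ _ (hsol n)).trans (isBigO_pow_of_le (by omega))).congr_left fun h => ?_
  exact SixPointScheme.residual_eq_stencilSum (fun i j hij => hf n i j (by omega))
    (fun i hi => hg n i (by omega)) h

end InterfaceDomain

end

theorem theorem2p4 (D : InterfaceDomain) (x₀ : ℝ)
    (hx₀ : x₀ ∈ Set.Ioo D.l₁ D.l₂) (hreg : D.ψ (x₀, D.l₄) ≠ 0) :
    -- sixth order of accuracy, and solvability of the system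
    (∀ (a : ℝ × ℝ → ℝ) (β : ℝ → ℝ), D.IsCoefficients 6 5 a β →
      (∃ c, SolvesSystem D x₀ a β c ∧ IsNontrivial c) ∧
      (∀ c, SolvesSystem D x₀ a β c →
        (robinScheme D x₀ a c).IsConsistent D x₀ a β 7 5 5 6 ∧
        (IsNontrivial c → (robinScheme D x₀ a c).HasAccuracyOrder D x₀ a β 7 5 5 6))) ∧
    -- six is the maximum order for each pair of smooth coefficients in general position
    (∀ (a : ℝ × ℝ → ℝ) (β : ℝ → ℝ), D.IsCoefficients ∞ ∞ a β →
      2 * a (x₀, D.l₄) * β x₀ ≠ D.dy a (x₀, D.l₄) →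
      IsGreatest {P : ℕ | ∃ S : SixPointScheme, S.HasAccuracyOrder D x₀ a β ∞ ∞ ∞ P} 6) ∧
    -- six is the maximum order available for all smooth coefficients
    IsGreatest {P : ℕ | ∀ (a : ℝ × ℝ → ℝ) (β : ℝ → ℝ), D.IsCoefficients ∞ ∞ a β →
      ∃ S : SixPointScheme, S.HasAccuracyOrder D x₀ a β ∞ ∞ ∞ P} 6 := by
  have htop : x₀ ∈ D.regularTop := ⟨hx₀, hreg⟩
  refine ⟨fun a β hab => ⟨InterfaceDomain.exists_solvesSystem, fun c hc => ?_⟩,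
    fun a β hab hne => ⟨InterfaceDomain.exists_hasAccuracyOrder_six htop hab, ?_⟩,
    fun a β hab => InterfaceDomain.exists_hasAccuracyOrder_six htop hab, fun P hP => ?_⟩
  · have hconsistent := (InterfaceDomain.isConsistent_robinScheme htop
      (hab.mono (by norm_num) le_rfl) hc).mono (ku' := 7) (kf' := 5) (kg' := 5) le_rfl
      (by norm_num) (by norm_num)
    exact ⟨hconsistent, fun hc' => ⟨InterfaceDomain.isNormalized_robinScheme hc', hconsistent⟩⟩
  · rintro P ⟨S, hS⟩
    exact InterfaceDomain.le_six_of_hasAccuracyOrder htop hab hne hS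
  · have hab : D.IsCoefficients ∞ ∞ (fun _ => 1) (fun _ => 1) :=
      ⟨fun _ _ => one_pos, contDiffOn_const, contDiffOn_const⟩
    obtain ⟨S, hS⟩ := hP _ _ hab
    refine InterfaceDomain.le_six_of_hasAccuracyOrder htop hab ?_ hS
    simp [InterfaceDomain.dy]
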